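/- For $f\in L^2(\mathbb R)$ (complex valued) let $\hat f(\xi)=\int_{\mathbb R} e^{-ix\xi}f(x)\,dx$ be its Fourier transform, in the sense of Plancherel. For $a>0$ and $f\in L^2(\mathbb R)$ such that $\hat f$ has bounded support, put $$S^af(x,t)=\frac1{2\pi}\int_{\mathbb R}e^{i(x\xi+t|\xi|^a)}\hat f(\xi)\,d\xi ,\qquad R^a_\delta f(x,t)=\frac{S^af(x,t)-f(x)}{|t|^\delta}.$$ Let $B=(-1,1)$, and for $\Lambda\ge1$ and $R>0$ let $A_\Lambda(R)=\{\xi\in\mathbb R:\Lambda^{-1}R\le|\xi|\le\Lambda R\}$. Let $0\le\delta<1$, and let either (i) $a>1$ and $s=(a-1)\delta+\max\{\delta,\tfrac14\}$, or (ii) $0<a<1$ and $s=a\max\{\delta,\tfrac14\}$. Then for every $\Lambda\ge1$ there is a constant $C=C(a,\delta,\Lambda)>0$ such that, for all integers $k\ge1$ and all $f\in L^2(\mathbb R)$ with $\operatorname{supp}\hat f\subset A_\Lambda(2^k)$, $$\Big\|\sup_{0<t<1}|R^a_\delta f(\cdot,t)|\Big\|_{L^2(B)}\le C\,k\,2^{ks}\,\|f\|_{L^2(\mathbb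 R)} .$$ Moreover, if $\delta\ne\tfrac14$, then the factor $k$ can be removed: for every $\Lambda\ge1$ there is a constant $C=C(a,\delta,\Lambda)>0$ such that the left-hand side is at most $C\,2^{ks}\|f\|_{L^2(\mathbb R)}$ for all such $k$ and $f$. -/

import Mathlib

open MeasureTheory
open scoped FourierTransform ENNReal

noncomputable section

/-- The Fourier transform of `f ∈ L²(ℝ)` (Plancherel) in the angular-frequency normalisation
`f̂(ξ) = ∫ e^{-ixξ} f(x) dx`. Mathlib's `𝓕` has the kernel `e^{-2πixη}`, so that
`f̂(ξ) = (𝓕 f)(ξ / 2π)`. -/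
def angularFourier (f : Lp ℂ 2 (volume : Measure ℝ)) (ξ : ℝ) : ℂ :=
  (𝓕 f : Lp ℂ 2 (volume : Measure ℝ)) (ξ / (2 * Real.pi))

/-- The Schrödinger type operator
`S^a f(x,t) = (1/2π) ∫ e^{i(xξ + t|ξ|^a)} f̂(ξ) dξ` in one dimension. The integral converges
absolutely whenever `f̂ ∈ L²` has bounded support, which is the only case considered. -/
def schrodingerOp (a : ℝ) (f : Lp ℂ 2 (volume : Measure ℝ)) (x t : ℝ) : ℂ :=
  (1 / (2 * Real.pi) : ℂ) *
    ∫ ξ : ℝ, Complex.exp (Complex.I * ((x * ξ + t * |ξ| ^ a : ℝ) : ℂ)) * angularFourier f ξ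

/-- The difference quotient `R_δ^a f(x,t) = (S^a f(x,t) - f(x)) / |t|^δ`. -/
def rateQuotient (a δ : ℝ) (f : Lp ℂ 2 (volume : Measure ℝ)) (x t : ℝ) : ℂ :=
  (schrodingerOp a f x t - f x) / ((|t| ^ δ : ℝ) : ℂ)

/-- The maximal function `x ↦ sup_{0<t<1} |R_δ^a f(x,t)|`, with values in `[0,∞]`. -/
def maximalRate (a δ : ℝ) (f : Lp ℂ 2 (volume : Measure ℝ)) (x : ℝ) : ℝ≥0∞ :=
  ⨆ t ∈ Set.Ioo (0 : ℝ) 1, ‖rateQuotient a δ f x t‖ₑ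

/-- The annulus `A(R) = {ξ : |ξ| ~ R}`, with comparability constant `Λ`. -/
def annulus (Λ R : ℝ) : Set ℝ := {ξ | R / Λ ≤ |ξ| ∧ |ξ| ≤ Λ * R}

/-- `supp f̂ ⊆ A`, for a closed set `A`: the class `f̂ ∈ L²` vanishes almost everywhere
outside `A`. -/
def FourierSupportedIn (f : Lp ℂ 2 (volume : Measure ℝ)) (A : Set ℝ) : Prop :=
  ∀ᵐ ξ : ℝ, ξ ∉ A → angularFourier f ξ = 0

/-- The frequency-localised maximal estimate with weights `w k`: for every comparability constant
`Λ` there is a constant `C`, independent of `k` and `f`, with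
`‖sup_{0<t<1} |R_δ^a f(·,t)|‖_{L²(B)} ≤ C w(k) ‖f‖_{L²(ℝ)}`
for all `k ≥ 1` and all `f ∈ L²(ℝ)` with `supp f̂ ⊆ A(2^k)`; here `B` is the unit ball of `ℝ`. -/
def LocalizedMaximalEstimate (a δ : ℝ) (w : ℕ → ℝ) : Prop :=
  ∀ Λ : ℝ, 1 ≤ Λ → ∃ C : ℝ, 0 < C ∧
    ∀ k : ℕ, 1 ≤ k → ∀ f : Lp ℂ 2 (volume : Measure ℝ),
      FourierSupportedIn f (annulus Λ ((2 : ℝ) ^ k)) →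
        eLpNorm (maximalRate a δ f) 2 (volume.restrict (Metric.ball (0 : ℝ) 1)) ≤
          ENNReal.ofReal (C * w k) * eLpNorm f 2 volume

end

/-!
The estimate is rescaled to unit frequency. Writing `ξ = ±2^k η`, the solution `S^a f` becomes the
sum of two integrals `oscOp a b B G x τ = ∫_b^B e^{i(xη + τη^a)} G(η) dη` with `x` in the ball of
radius `2^k` and `0 < τ < 2^{ka}` (`schrodingerOp_eq_oscOp`); that the initial datum is
`S^a f(·, 0)` almost everywhere is Fourier inversion on `L²` (`ae_eq_fourierInv_of_integrable`). The scaling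
produces the factor `2^{kaδ}`.

At unit frequency the main point is the maximal estimate `exists_eLpNorm_oscMax_le`: the supremum
of `|oscOp|` over `0 ≤ τ ≤ N`, in the ball of radius `ρ`, has `L²` norm at most `C M^{1/4} ‖G‖₂`
as soon as `N ≤ M` or `ρ ≤ M`. It follows from the `T T*` method for the operator linearised by a
measurable choice of the time, `G ↦ oscOp G x (τ x)` (`lintegral_biSup_sq_le_of_linearised`,
`lintegral_enorm_sq_le_of_kernel_bound`). The kernel of `T T*` is `O((1 + |X|)^{-1/2})` uniformly
in time, by the second derivative test of van der Corput (this is where `a ≠ 1` enters), and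
`O((1 + |X|)^{-2})` where `|X|` exceeds a multiple of `|τ|`, by non-stationary phase
(`exists_norm_oscKernel_le`). Its majorant therefore has integral `O(M^{1/2})`, and Schur's test
gives `‖T‖² ≲ M^{1/2}`.

The supremum of the difference quotient is split dyadically (`oscRate_le`). The times `τ ≤ 1` are
controlled by the time derivative, that is by the maximal estimate for `η^a G`; the times
`τ ~ 2^j` contribute `2^{j(1/4 - δ)}`. The decomposition stops at `2^J`: for `a < 1` there are no times
beyond `2^J ~ 2^{ka}`, while for `a > 1` one takes `J = k` and bounds all later times at once by
the maximal estimate in the ball of radius `2^k`. The geometric sum `∑_{j ≤ J} 2^{j(1/4 - δ)}` is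
comparable to its largest term if `δ ≠ 1/4`, and is at most `J + 1` times its largest term in
general; this is the origin of the factor `k`.
-/

/-! ### The `T T*` method -/

section TTStar

open ComplexConjugate Function

variable {α β : Type*} [MeasurableSpace α] [MeasurableSpace β] {ν : Measure α} {μ : Measure β}
  {e : α → β → ℂ} {L : ℝ}

theorem ofReal_integral_norm_sq {F : β → ℂ} (hF : MemLp F 2 μ) :
    ENNReal.ofReal (∫ ξ, ‖F ξ‖ ^ 2 ∂μ) = ∫⁻ ξ, ‖F ξ‖ₑ ^ 2 ∂μ := by
  rw [ofReal_integral_eq_lintegral_ofReal hF.norm.integrable_sq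
    (Filter.Eventually.of_forall fun _ => sq_nonneg _)]
  simp_rw [ENNReal.ofReal_pow (norm_nonneg _), ofReal_norm]

theorem integrable_kernel_mul_mul [SFinite ν] [SFinite μ]
    (he : Measurable (uncurry e)) (hb : ∀ x ξ, ‖e x ξ‖ ≤ L)
    {F : β → ℂ} (hF : Integrable F μ) {h : α → ℂ} (hh : Integrable h ν) :
    Integrable (fun p : α × β => e p.1 p.2 * (h p.1 * F p.2)) (ν.prod μ) :=
  (hh.mul_prod hF).bdd_mul he.aestronglyMeasurable (Filter.Eventually.of_forall fun p => hb p.1 p.2)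

/-- The operator with kernel `conj (e x ξ)` is adjoint to the one with kernel `e x ξ`. -/
theorem integral_conj_adjoint_mul [SFinite ν] [SFinite μ]
    (he : Measurable (uncurry e)) (hb : ∀ x ξ, ‖e x ξ‖ ≤ L)
    {F : β → ℂ} (hF : Integrable F μ) {h : α → ℂ} (hh : Integrable h ν) :
    ∫ ξ, conj (∫ x, conj (e x ξ) * h x ∂ν) * F ξ ∂μ
      = ∫ x, conj (h x) * ∫ ξ, e x ξ * F ξ ∂μ ∂ν := by
  have hh' : Integrable (fun x => conj (h x)) ν :=
    hh.congr' (RCLike.continuous_conj.comp_aestronglyMeasurable hh.1) (by simp)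
  have hint := integrable_kernel_mul_mul he hb hF hh'
  have h1 : ∀ ξ, conj (∫ x, conj (e x ξ) * h x ∂ν) * F ξ
      = ∫ x, e x ξ * (conj (h x) * F ξ) ∂ν := by
    intro ξ
    rw [← integral_conj, ← integral_mul_const]
    refine integral_congr_ae (Filter.Eventually.of_forall fun x => ?_)
    simp [mul_assoc]
  have h2 : ∀ x, conj (h x) * ∫ ξ, e x ξ * F ξ ∂μ
      = ∫ ξ, e x ξ * (conj (h x) * F ξ) ∂μ := by
    intro x
    rw [← integral_const_mul]
    refine integral_congr_ae (Filter.Eventually.of_forall fun x => ?_)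
    simp only
    ring
  simp_rw [h1, h2]
  exact (integral_integral_swap hint).symm

/-- Schur's test for a symmetric nonnegative kernel. -/
theorem integral_mul_integral_mul_le_of_schur [IsFiniteMeasure ν] {k : α → α → ℝ}
    (hk : Measurable (uncurry k)) {M : ℝ} (hkM : ∀ x y, |k x y| ≤ M)
    (hk0 : ∀ x y, 0 ≤ k x y) (hsymm : ∀ x y, k x y = k y x)
    {A : ℝ} (hA : ∀ᵐ x ∂ν, ∫ y, k x y ∂ν ≤ A) {g : α → ℝ}
    (hg : MemLp g 2 ν) :
    ∫ x, g x * ∫ y, k x y * g y ∂ν ∂ν ≤ A * ∫ x, g x ^ 2 ∂ν := by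
  have hg1 : Integrable g ν := hg.integrable (by norm_num)
  have hg2 : Integrable (fun x => g x ^ 2) ν := hg.integrable_sq
  have hbd : ∀ {u : α × α → ℝ}, Integrable u (ν.prod ν) →
      Integrable (fun p : α × α => k p.1 p.2 * u p) (ν.prod ν) := fun hu =>
    hu.bdd_mul hk.aestronglyMeasurable (Filter.Eventually.of_forall fun p => hkM p.1 p.2)
  have i0 := hbd (hg1.mul_prod hg1)
  have i1 := hbd (hg2.comp_fst ν)
  have i2 := hbd (hg2.comp_snd ν)
  have e0 : ∫ x, g x * ∫ y, k x y * g y ∂ν ∂ν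
      = ∫ p : α × α, k p.1 p.2 * (g p.1 * g p.2) ∂(ν.prod ν) := by
    rw [integral_prod _ i0]
    refine integral_congr_ae (Filter.Eventually.of_forall fun x => ?_)
    simp only
    rw [← integral_const_mul]
    refine integral_congr_ae (Filter.Eventually.of_forall fun y => ?_)
    simp only
    ring
  have e1 : ∫ p : α × α, k p.1 p.2 * g p.1 ^ 2 ∂(ν.prod ν) ≤ A * ∫ x, g x ^ 2 ∂ν := by
    rw [integral_prod _ i1, ← integral_const_mul]
    refine integral_mono_ae i1.integral_prod_left (hg2.const_mul A) ?_
    filter_upwards [hA] with x hx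
    rw [integral_mul_const]
    exact mul_le_mul_of_nonneg_right hx (sq_nonneg _)
  have e2 : ∫ p : α × α, k p.1 p.2 * g p.2 ^ 2 ∂(ν.prod ν)
      = ∫ p : α × α, k p.1 p.2 * g p.1 ^ 2 ∂(ν.prod ν) := by
    refine (integral_prod_swap (μ := ν) (ν := ν)
      fun p : α × α => k p.1 p.2 * g p.2 ^ 2).symm.trans ?_
    refine integral_congr_ae (Filter.Eventually.of_forall fun p => ?_)
    change k p.2 p.1 * g p.1 ^ 2 = k p.1 p.2 * g p.1 ^ 2
    rw [hsymm]
  rw [e0]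
  calc ∫ p : α × α, k p.1 p.2 * (g p.1 * g p.2) ∂(ν.prod ν)
      ≤ ∫ p : α × α, (1 / 2 * (k p.1 p.2 * g p.1 ^ 2) + 1 / 2 * (k p.1 p.2 * g p.2 ^ 2))
          ∂(ν.prod ν) := by
        refine integral_mono i0 ((i1.const_mul _).add (i2.const_mul _)) fun p => ?_
        have := mul_nonneg (hk0 p.1 p.2) (sq_nonneg (g p.1 - g p.2))
        simp only
        nlinarith
    _ = ∫ p : α × α, k p.1 p.2 * g p.1 ^ 2 ∂(ν.prod ν) := by
        rw [integral_add (i1.const_mul _) (i2.const_mul _), integral_const_mul,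
          integral_const_mul, e2]
        ring
    _ ≤ _ := e1

/-- The `T T*` method: if the kernel of `T T*`, where `T F x = ∫ e x ξ F ξ`, is dominated by `k` and
`k` satisfies Schur's test with constant `A`, then `‖T‖² ≤ A`. -/
theorem lintegral_enorm_sq_le_of_kernel_bound [IsFiniteMeasure ν] [IsFiniteMeasure μ]
    (he : Measurable (uncurry e))
    (hb : ∀ x ξ, ‖e x ξ‖ ≤ L) {k : α → α → ℝ} (hk : Measurable (uncurry k))
    {M : ℝ} (hkM : ∀ x y, |k x y| ≤ M) (hk0 : ∀ x y, 0 ≤ k x y) (hsymm : ∀ x y, k x y = k y x)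
    (hK : ∀ᵐ x ∂ν, ∀ᵐ y ∂ν, ‖∫ ξ, e x ξ * conj (e y ξ) ∂μ‖ ≤ k x y)
    {A : ℝ} (hA0 : 0 < A) (hA : ∀ᵐ x ∂ν, ∫ y, k x y ∂ν ≤ A) {F : β → ℂ} (hF : MemLp F 2 μ) :
    ∫⁻ x, ‖∫ ξ, e x ξ * F ξ ∂μ‖ₑ ^ 2 ∂ν ≤ ENNReal.ofReal A * ∫⁻ ξ, ‖F ξ‖ₑ ^ 2 ∂μ := by
  have hF1 : Integrable F μ := hF.integrable (by norm_num)
  set h : α → ℂ := fun x => ∫ ξ, e x ξ * F ξ ∂μ with hh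
  have hhmeas : AEStronglyMeasurable h ν := by
    refine AEStronglyMeasurable.integral_prod_right' (f := fun p : α × β => e p.1 p.2 * F p.2) ?_
    exact he.aestronglyMeasurable.mul hF1.1.comp_snd
  have hhbd : ∀ x, ‖h x‖ ≤ ∫ ξ, L * ‖F ξ‖ ∂μ := fun x =>
    norm_integral_le_of_norm_le (hF1.norm.const_mul L) (Filter.Eventually.of_forall fun ξ => by
      rw [norm_mul]
      exact mul_le_mul_of_nonneg_right (hb x ξ) (norm_nonneg _))
  have hh2 : MemLp h 2 ν := MemLp.of_bound hhmeas _ (Filter.Eventually.of_forall hhbd)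
  have hh1 : Integrable h ν := hh2.integrable (by norm_num)
  set H : β → ℂ := fun ξ => ∫ x, conj (e x ξ) * h x ∂ν with hH
  have hcm : Measurable (fun p : α × β => conj (e p.1 p.2)) :=
    RCLike.continuous_conj.measurable.comp he
  have hHmeas : AEStronglyMeasurable H μ := by
    refine AEStronglyMeasurable.integral_prod_right'
      (f := fun p : β × α => conj (e p.2 p.1) * h p.2) ?_
    exact (hcm.comp measurable_swap).aestronglyMeasurable.mul hhmeas.comp_snd
  have hHbd : ∀ ξ, ‖H ξ‖ ≤ ∫ x, L * ‖h x‖ ∂ν := fun ξ =>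
    norm_integral_le_of_norm_le (hh1.norm.const_mul L) (Filter.Eventually.of_forall fun x => by
      rw [norm_mul, RCLike.norm_conj]
      exact mul_le_mul_of_nonneg_right (hb x ξ) (norm_nonneg _))
  have hH2 : MemLp H 2 μ := MemLp.of_bound hHmeas _ (Filter.Eventually.of_forall hHbd)
  have hH1 : Integrable H μ := hH2.integrable (by norm_num)
  rw [← ofReal_integral_norm_sq hh2, ← ofReal_integral_norm_sq hF, ← ENNReal.ofReal_mul hA0.le]
  refine ENNReal.ofReal_le_ofReal ?_
  have hsq : ∀ z : ℂ, conj z * z = ((‖z‖ ^ 2 : ℝ) : ℂ) := fun z => by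
    rw [RCLike.conj_mul]; norm_cast
  -- `⟨H, F⟩ = ‖h‖²`
  have a1 : ∫ ξ, conj (H ξ) * F ξ ∂μ = ((∫ x, ‖h x‖ ^ 2 ∂ν : ℝ) : ℂ) := by
    rw [hH, integral_conj_adjoint_mul he hb hF1 hh1, ← integral_complex_ofReal]
    exact integral_congr_ae (Filter.Eventually.of_forall fun x => hsq (h x))
  -- `‖H‖² ≤ A ‖h‖²`
  have a2 : ∫ ξ, ‖H ξ‖ ^ 2 ∂μ ≤ A * ∫ x, ‖h x‖ ^ 2 ∂ν := by
    have b1 : ((∫ ξ, ‖H ξ‖ ^ 2 ∂μ : ℝ) : ℂ) = ∫ x, conj (h x) * ∫ ξ, e x ξ * H ξ ∂μ ∂ν := by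
      rw [← integral_conj_adjoint_mul he hb hH1 hh1, ← integral_complex_ofReal]
      exact (integral_congr_ae (Filter.Eventually.of_forall fun x => hsq (H x))).symm
    have b2 : ∀ x, ∫ ξ, e x ξ * H ξ ∂μ = ∫ y, (∫ ξ, e x ξ * conj (e y ξ) ∂μ) * h y ∂ν := by
      intro x
      have c1 : ∀ ξ, e x ξ * H ξ = ∫ y, conj (e y ξ) * (h y * e x ξ) ∂ν := by
        intro ξ
        rw [hH, ← integral_const_mul]
        refine integral_congr_ae (Filter.Eventually.of_forall fun y => ?_)
        simp only
        ring
      have c2 : ∀ y, (∫ ξ, e x ξ * conj (e y ξ) ∂μ) * h y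
          = ∫ ξ, conj (e y ξ) * (h y * e x ξ) ∂μ := by
        intro y
        rw [← integral_mul_const]
        refine integral_congr_ae (Filter.Eventually.of_forall fun ξ => ?_)
        simp only
        ring
      simp_rw [c1, c2]
      refine (integral_integral_swap (f := fun y ξ => conj (e y ξ) * (h y * e x ξ)) ?_).symm
      refine integrable_kernel_mul_mul (e := fun y ξ => conj (e y ξ)) hcm
        (fun x ξ => by simpa using hb x ξ) ?_ hh1
      exact (integrable_const L).mono' (he.comp measurable_prodMk_left).aestronglyMeasurable
        (Filter.Eventually.of_forall (hb x))
    have hk_int : ∀ x, Integrable (fun y => k x y * ‖h y‖) ν := fun x =>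
      hh1.norm.bdd_mul (hk.comp measurable_prodMk_left).aestronglyMeasurable
        (Filter.Eventually.of_forall fun y => hkM x y)
    have b3 : ∀ᵐ x ∂ν, ‖conj (h x) * ∫ ξ, e x ξ * H ξ ∂μ‖ ≤ ‖h x‖ * ∫ y, k x y * ‖h y‖ ∂ν := by
      filter_upwards [hK] with x hx
      rw [norm_mul, RCLike.norm_conj, b2]
      refine mul_le_mul_of_nonneg_left ?_ (norm_nonneg _)
      refine norm_integral_le_of_norm_le (hk_int x) ?_
      filter_upwards [hx] with y hy
      rw [norm_mul]
      exact mul_le_mul_of_nonneg_right hy (norm_nonneg _)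
    have b4 : Integrable (fun x => ‖h x‖ * ∫ y, k x y * ‖h y‖ ∂ν) ν := by
      have : Integrable (fun p : α × α => k p.1 p.2 * (‖h p.1‖ * ‖h p.2‖)) (ν.prod ν) :=
        (hh1.norm.mul_prod hh1.norm).bdd_mul hk.aestronglyMeasurable
          (Filter.Eventually.of_forall fun p => hkM p.1 p.2)
      refine this.integral_prod_left.congr (Filter.Eventually.of_forall fun x => ?_)
      simp only
      rw [← integral_const_mul]
      refine integral_congr_ae (Filter.Eventually.of_forall fun y => ?_)
      simp only
      ring
    calc ∫ ξ, ‖H ξ‖ ^ 2 ∂μ = ‖((∫ ξ, ‖H ξ‖ ^ 2 ∂μ : ℝ) : ℂ)‖ := by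
          rw [Complex.norm_real, Real.norm_of_nonneg (integral_nonneg fun _ => by positivity)]
      _ ≤ ∫ x, ‖h x‖ * ∫ y, k x y * ‖h y‖ ∂ν ∂ν := by
          rw [b1]; exact norm_integral_le_of_norm_le b4 b3
      _ ≤ _ := integral_mul_integral_mul_le_of_schur hk hkM hk0 hsymm hA hh2.norm
  -- Expanding `0 ≤ ‖F - A⁻¹ H‖²` concludes.
  have i1 : Integrable (fun ξ => ‖F ξ‖ ^ 2) μ := hF.norm.integrable_sq
  have i2 : Integrable (fun ξ => ‖H ξ‖ ^ 2) μ := hH2.norm.integrable_sq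
  have i3 : Integrable (fun ξ => conj (H ξ) * F ξ) μ :=
    hF1.bdd_mul (RCLike.continuous_conj.comp_aestronglyMeasurable hHmeas)
      (Filter.Eventually.of_forall fun ξ => by rw [RCLike.norm_conj]; exact hHbd ξ)
  have a3 : ∫ ξ, (conj (H ξ) * F ξ).re ∂μ = ∫ x, ‖h x‖ ^ 2 ∂ν := by
    have := integral_re i3
    simp only [RCLike.re_to_complex] at this
    rw [this, a1, Complex.ofReal_re]
  have a4 : 0 ≤ ∫ ξ, (‖F ξ‖ ^ 2 - 2 * A⁻¹ * (conj (H ξ) * F ξ).re + A⁻¹ ^ 2 * ‖H ξ‖ ^ 2) ∂μ := by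
    refine integral_nonneg fun ξ => ?_
    have : ‖F ξ‖ ^ 2 - 2 * A⁻¹ * (conj (H ξ) * F ξ).re + A⁻¹ ^ 2 * ‖H ξ‖ ^ 2
        = ‖F ξ - (A⁻¹ : ℝ) * H ξ‖ ^ 2 := by
      simp only [← Complex.normSq_eq_norm_sq, Complex.normSq_apply]
      simp
      ring
    simp only [Pi.zero_apply]
    rw [this]
    positivity
  have i3' : Integrable (fun ξ => 2 * A⁻¹ * (conj (H ξ) * F ξ).re) μ := i3.re.const_mul _
  rw [integral_add (f := fun ξ => ‖F ξ‖ ^ 2 - 2 * A⁻¹ * (conj (H ξ) * F ξ).re) (i1.sub i3')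
    (i2.const_mul _), integral_sub i1 i3', integral_const_mul, integral_const_mul, a3] at a4
  set P := ∫ x, ‖h x‖ ^ 2 ∂ν
  set Q := ∫ ξ, ‖F ξ‖ ^ 2 ∂μ
  have a5 : A⁻¹ ^ 2 * ∫ ξ, ‖H ξ‖ ^ 2 ∂μ ≤ A⁻¹ ^ 2 * (A * P) :=
    mul_le_mul_of_nonneg_left a2 (by positivity)
  have a6 : A⁻¹ ^ 2 * (A * P) = A⁻¹ * P := by field_simp
  have a7 : A⁻¹ * P ≤ Q := by linarith
  calc P = A * (A⁻¹ * P) := by field_simp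
    _ ≤ A * Q := mul_le_mul_of_nonneg_left a7 hA0.le

end TTStar

/-! ### Linearisation of maximal functions -/

section Linearisation

variable {X : Type*} [TopologicalSpace X] [MeasurableSpace X] [OpensMeasurableSpace X]

/-- Kolmogorov–Seliverstov linearisation: the maximal function of a continuous family is bounded in
`L²` by the uniform `L²` bound over all measurable choices `x ↦ τ x` of the parameter. -/
theorem lintegral_biSup_sq_le_of_linearised {ν : Measure X} {u : X → ℝ → ℂ}
    (hu : Continuous (Function.uncurry u)) {S : Set ℝ} (hS : S.Nonempty) {A : ℝ≥0∞}
    (hA : ∀ τ : X → ℝ, Measurable τ → (∀ x, τ x ∈ S) → ∫⁻ x, ‖u x (τ x)‖ₑ ^ 2 ∂ν ≤ A) :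
    ∫⁻ x, (⨆ t ∈ S, ‖u x t‖ₑ) ^ 2 ∂ν ≤ A := by
  classical
  have : Nonempty S := hS.to_subtype
  have hux : ∀ t, Measurable fun x => ‖u x t‖ₑ := fun t =>
    (hu.comp (Continuous.prodMk continuous_id continuous_const)).enorm.measurable
  set q : ℕ → S := TopologicalSpace.denseSeq S with hq
  -- the choice among the first `n + 1` points of the sequence which maximises `‖u x ·‖`
  let τ : ℕ → X → ℝ := fun n => Nat.rec (fun _ => (q 0 : ℝ))
    (fun n τ x => if ‖u x (τ x)‖ₑ ≤ ‖u x (q (n + 1))‖ₑ then (q (n + 1) : ℝ) else τ x) n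
  have τ0 : τ 0 = fun _ => (q 0 : ℝ) := rfl
  have τs : ∀ n, τ (n + 1) =
      fun x => if ‖u x (τ n x)‖ₑ ≤ ‖u x (q (n + 1))‖ₑ then (q (n + 1) : ℝ) else τ n x :=
    fun n => rfl
  have both : ∀ n, Measurable (τ n) ∧ (Measurable fun x => ‖u x (τ n x)‖ₑ) ∧ ∀ x, τ n x ∈ S := by
    intro n
    induction n with
    | zero => exact ⟨measurable_const, hux _, fun x => (q 0).2⟩
    | succ n ih =>
      obtain ⟨m1, m2, m3⟩ := ih
      have hset : MeasurableSet {x | ‖u x (τ n x)‖ₑ ≤ ‖u x (q (n + 1))‖ₑ} :=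
        measurableSet_le m2 (hux _)
      refine ⟨?_, ?_, fun x => ?_⟩
      · rw [τs]
        exact Measurable.ite hset measurable_const m1
      · have : (fun x => ‖u x (τ (n + 1) x)‖ₑ) = fun x =>
            if ‖u x (τ n x)‖ₑ ≤ ‖u x (q (n + 1))‖ₑ then ‖u x (q (n + 1))‖ₑ
            else ‖u x (τ n x)‖ₑ := by
          funext x
          rw [τs]
          dsimp only
          split_ifs <;> rfl
        rw [this]
        exact Measurable.ite hset (hux _) m2
      · rw [τs]
        simp only
        split_ifs
        · exact (q (n + 1)).2
        · exact m3 x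
  have step : ∀ n x, ‖u x (τ n x)‖ₑ ≤ ‖u x (τ (n + 1) x)‖ₑ ∧
      ‖u x (q (n + 1))‖ₑ ≤ ‖u x (τ (n + 1) x)‖ₑ := by
    intro n x
    rw [τs]
    simp only
    split_ifs with h
    · exact ⟨h, le_rfl⟩
    · exact ⟨le_rfl, (not_le.mp h).le⟩
  have mono : ∀ x, Monotone fun n => ‖u x (τ n x)‖ₑ := fun x =>
    monotone_nat_of_le_succ fun n => (step n x).1
  have hle : ∀ x, (⨆ t ∈ S, ‖u x t‖ₑ) ≤ ⨆ n, ‖u x (τ n x)‖ₑ := by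
    intro x
    refine iSup₂_le fun t ht => ?_
    have hcl : IsClosed {t : S | ‖u x t‖ₑ ≤ ⨆ n, ‖u x (τ n x)‖ₑ} := by
      refine isClosed_le ?_ continuous_const
      exact (hu.comp (Continuous.prodMk continuous_const continuous_subtype_val)).enorm
    refine (TopologicalSpace.denseRange_denseSeq S).induction_on
      (p := fun t : S => ‖u x t‖ₑ ≤ ⨆ n, ‖u x (τ n x)‖ₑ) ⟨t, ht⟩ hcl fun n => ?_
    cases n with
    | zero => exact le_iSup (fun n => ‖u x (τ n x)‖ₑ) 0
    | succ n => exact (step n x).2.trans (le_iSup (fun n => ‖u x (τ n x)‖ₑ) (n + 1))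
  calc ∫⁻ x, (⨆ t ∈ S, ‖u x t‖ₑ) ^ 2 ∂ν ≤ ∫⁻ x, ⨆ n, ‖u x (τ n x)‖ₑ ^ 2 ∂ν := by
        refine lintegral_mono fun x => ?_
        have h2 : (⨆ n, ‖u x (τ n x)‖ₑ) ^ 2 = ⨆ n, ‖u x (τ n x)‖ₑ ^ 2 := by
          have := Monotone.map_iSup_of_continuousAt (f := fun z : ℝ≥0∞ => z ^ 2)
            (g := fun n => ‖u x (τ n x)‖ₑ) (ENNReal.continuous_pow 2).continuousAt
            (fun a b h => pow_le_pow_left' h 2) (by simp)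
          simpa using this
        rw [← h2]
        gcongr
        exact hle x
    _ = ⨆ n, ∫⁻ x, ‖u x (τ n x)‖ₑ ^ 2 ∂ν := by
        refine lintegral_iSup (fun n => (both n).2.1.pow_const 2) fun m n hmn x => ?_
        exact pow_le_pow_left' (mono x hmn) 2
    _ ≤ A := iSup_le fun n => hA _ (both n).1 (both n).2.2

end Linearisation

/-! ### Oscillatory integrals -/

section Oscillatory

open Complex Set

/-- Integration by parts against `e^{iφ}` with `φ' = g`. -/
theorem norm_integral_cexp_mul_deriv_le {φ g V V' : ℝ → ℝ} {p q : ℝ}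
    (hφ : ∀ x ∈ uIcc p q, HasDerivAt φ (g x) x) (hV : ∀ x ∈ uIcc p q, HasDerivAt V (V' x) x)
    (hg : ContinuousOn g (uIcc p q)) (hV' : ContinuousOn V' (uIcc p q)) :
    ‖∫ x in p..q, cexp (I * φ x) * ((g x * V x : ℝ) : ℂ)‖
      ≤ |V q| + |V p| + ‖∫ x in p..q, cexp (I * φ x) * (V' x : ℂ)‖ := by
  have hφc : ContinuousOn φ (uIcc p q) := fun x hx => (hφ x hx).continuousAt.continuousWithinAt
  have hVc : ContinuousOn V (uIcc p q) := fun x hx => (hV x hx).continuousAt.continuousWithinAt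
  have hexp : ∀ x ∈ uIcc p q,
      HasDerivAt (fun x => cexp (I * φ x)) (cexp (I * φ x) * (I * g x)) x := fun x hx =>
    (((hφ x hx).ofReal_comp).const_mul I).cexp
  have hec : ContinuousOn (fun x => cexp (I * φ x)) (uIcc p q) := fun x hx =>
    (hexp x hx).continuousAt.continuousWithinAt
  have ofR : ∀ {u : ℝ → ℝ}, ContinuousOn u (uIcc p q) →
      ContinuousOn (fun x => (u x : ℂ)) (uIcc p q) := fun hu =>
    continuous_ofReal.comp_continuousOn hu
  have i1 : IntervalIntegrable (fun x => cexp (I * φ x) * ((g x * V x : ℝ) : ℂ)) volume p q :=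
    (hec.mul (ofR (hg.mul hVc))).intervalIntegrable
  have i2 : IntervalIntegrable (fun x => cexp (I * φ x) * (V' x : ℂ)) volume p q :=
    (hec.mul (ofR hV')).intervalIntegrable
  have key := intervalIntegral.integral_deriv_mul_eq_sub hexp
    (fun x hx => (hV x hx).ofReal_comp)
    (hec.mul (continuousOn_const.mul (ofR hg))).intervalIntegrable
    (ofR hV').intervalIntegrable
  have e1 : ∫ x in p..q, (cexp (I * φ x) * (I * g x) * (V x : ℂ) + cexp (I * φ x) * (V' x : ℂ))
      = I * (∫ x in p..q, cexp (I * φ x) * ((g x * V x : ℝ) : ℂ))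
        + ∫ x in p..q, cexp (I * φ x) * (V' x : ℂ) := by
    rw [← intervalIntegral.integral_const_mul, ← intervalIntegral.integral_add (i1.const_mul _) i2]
    refine intervalIntegral.integral_congr fun x _ => ?_
    push_cast
    ring
  rw [e1] at key
  have nexp : ∀ x : ℝ, ‖cexp (I * φ x)‖ = 1 := fun x => norm_exp_I_mul_ofReal _
  have e2 : I * (∫ x in p..q, cexp (I * φ x) * ((g x * V x : ℝ) : ℂ))
      = cexp (I * φ q) * V q - cexp (I * φ p) * V p
        - ∫ x in p..q, cexp (I * φ x) * (V' x : ℂ) := by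
    rw [← key]; ring
  calc ‖∫ x in p..q, cexp (I * φ x) * ((g x * V x : ℝ) : ℂ)‖
      = ‖I * ∫ x in p..q, cexp (I * φ x) * ((g x * V x : ℝ) : ℂ)‖ := by simp
    _ ≤ ‖cexp (I * φ q) * V q‖ + ‖cexp (I * φ p) * V p‖
        + ‖∫ x in p..q, cexp (I * φ x) * (V' x : ℂ)‖ := by
      rw [e2]
      exact (norm_sub_le _ _).trans (add_le_add_left (norm_sub_le _ _) _)
    _ = _ := by rw [norm_mul, norm_mul, nexp, nexp]; simp

theorem norm_integral_cexp_mul_ofReal_le {φ v : ℝ → ℝ} {p q M : ℝ} (hpq : p ≤ q)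
    (hM : ∀ x ∈ Icc p q, |v x| ≤ M) :
    ‖∫ x in p..q, cexp (I * φ x) * (v x : ℂ)‖ ≤ M * (q - p) := by
  have := intervalIntegral.norm_integral_le_of_norm_le_const (a := p) (b := q) (C := M)
    (f := fun x => cexp (I * φ x) * (v x : ℂ)) fun x hx => by
      rw [uIoc_of_le hpq] at hx
      rw [norm_mul, norm_exp_I_mul_ofReal, one_mul, norm_real]
      exact hM x (Ioc_subset_Icc_self hx)
  rwa [abs_of_nonneg (sub_nonneg.mpr hpq)] at this

/-- Non-stationary phase: two integrations by parts, for an amplitude vanishing to second order at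
the end points. -/
theorem norm_integral_cexp_le_of_nonstationary {φ g g₁ g₂ w w₁ w₂ : ℝ → ℝ} {p q : ℝ} (hpq : p ≤ q)
    (hφ : ∀ x ∈ Icc p q, HasDerivAt φ (g x) x) (hg : ∀ x ∈ Icc p q, HasDerivAt g (g₁ x) x)
    (hg₁ : ∀ x ∈ Icc p q, HasDerivAt g₁ (g₂ x) x) (hg₂ : ContinuousOn g₂ (Icc p q))
    (hw : ∀ x ∈ Icc p q, HasDerivAt w (w₁ x) x) (hw₁ : ∀ x ∈ Icc p q, HasDerivAt w₁ (w₂ x) x)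
    (hw₂ : ContinuousOn w₂ (Icc p q)) (hwp : w p = 0) (hwq : w q = 0) (hwp₁ : w₁ p = 0)
    (hwq₁ : w₁ q = 0) {m K D : ℝ} (hm : 0 < m) (hgm : ∀ x ∈ Icc p q, m ≤ |g x|)
    (hK₁ : ∀ x ∈ Icc p q, |g₁ x| ≤ K * m) (hK₂ : ∀ x ∈ Icc p q, |g₂ x| ≤ K * m)
    (hD : ∀ x ∈ Icc p q, |w x| ≤ D) (hD₁ : ∀ x ∈ Icc p q, |w₁ x| ≤ D)
    (hD₂ : ∀ x ∈ Icc p q, |w₂ x| ≤ D) :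
    ‖∫ x in p..q, cexp (I * φ x) * (w x : ℂ)‖
      ≤ D * (1 + 4 * K + 3 * K ^ 2) * (q - p) / m ^ 2 := by
  have hu : uIcc p q = Icc p q := uIcc_of_le hpq
  have hg0 : ∀ x ∈ Icc p q, g x ≠ 0 := fun x hx h => by
    have := hgm x hx
    rw [h, abs_zero] at this
    linarith
  have cont : ∀ {u u' : ℝ → ℝ}, (∀ x ∈ Icc p q, HasDerivAt u (u' x) x) →
      ContinuousOn u (Icc p q) := fun h x hx => (h x hx).continuousAt.continuousWithinAt
  set V : ℝ → ℝ := fun x => w x / g x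
  set V' : ℝ → ℝ := fun x => (w₁ x * g x - w x * g₁ x) / g x ^ 2
  set U : ℝ → ℝ := fun x => V' x / g x
  set U' : ℝ → ℝ := fun x => w₂ x / g x ^ 2 - 3 * (w₁ x * g₁ x) / g x ^ 3 - w x * g₂ x / g x ^ 3
    + 3 * (w x * g₁ x ^ 2) / g x ^ 4
  have hV : ∀ x ∈ Icc p q, HasDerivAt V (V' x) x := fun x hx =>
    (hw x hx).div (hg x hx) (hg0 x hx)
  have hU : ∀ x ∈ Icc p q, HasDerivAt U (U' x) x := by
    intro x hx
    have h0 := hg0 x hx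
    have h1 := (((hw₁ x hx).mul (hg x hx)).sub ((hw x hx).mul (hg₁ x hx))).div
      ((hg x hx).pow 2) (pow_ne_zero 2 h0)
    refine (h1.div (hg x hx) h0).congr_deriv ?_
    simp only [U', Pi.mul_apply, Pi.sub_apply, Pi.pow_apply, Pi.div_apply]
    field_simp
    push_cast
    ring
  have hV'c : ContinuousOn V' (Icc p q) := by
    refine ContinuousOn.div ?_ ((cont hg).pow 2) fun x hx => pow_ne_zero 2 (hg0 x hx)
    exact ((cont hw₁).mul (cont hg)).sub ((cont hw).mul (cont hg₁))
  have hU'c : ContinuousOn U' (Icc p q) := by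
    have a := cont hw
    have b := cont hw₁
    have c := cont hg
    have d := cont hg₁
    have nz : ∀ n : ℕ, ∀ x ∈ Icc p q, g x ^ n ≠ 0 := fun n x hx => pow_ne_zero n (hg0 x hx)
    exact (((hw₂.div (c.pow 2) (nz 2)).sub ((continuousOn_const.mul (b.mul d)).div (c.pow 3)
      (nz 3))).sub ((a.mul hg₂).div (c.pow 3) (nz 3))).add
      ((continuousOn_const.mul (a.mul (d.pow 2))).div (c.pow 4) (nz 4))
  have s1 := norm_integral_cexp_mul_deriv_le (φ := φ) (g := g) (V := V) (V' := V') (p := p) (q := q)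
    (by rwa [hu]) (by rwa [hu]) (by rw [hu]; exact cont hg) (by rwa [hu])
  have s2 := norm_integral_cexp_mul_deriv_le (φ := φ) (g := g) (V := U) (V' := U') (p := p) (q := q)
    (by rwa [hu]) (by rwa [hu]) (by rw [hu]; exact cont hg) (by rwa [hu])
  have c1 : ∫ x in p..q, cexp (I * φ x) * ((g x * V x : ℝ) : ℂ)
      = ∫ x in p..q, cexp (I * φ x) * (w x : ℂ) := by
    refine intervalIntegral.integral_congr fun x hx => ?_
    rw [hu] at hx
    simp only [V, mul_div_cancel₀ _ (hg0 x hx)]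
  have c2 : ∫ x in p..q, cexp (I * φ x) * ((g x * U x : ℝ) : ℂ)
      = ∫ x in p..q, cexp (I * φ x) * (V' x : ℂ) := by
    refine intervalIntegral.integral_congr fun x hx => ?_
    rw [hu] at hx
    simp only [U, mul_div_cancel₀ _ (hg0 x hx)]
  have z : V q = 0 ∧ V p = 0 ∧ U q = 0 ∧ U p = 0 := by
    simp [V, U, V', hwp, hwq, hwp₁, hwq₁]
  rw [c1, z.1, z.2.1] at s1
  rw [c2, z.2.2.1, z.2.2.2] at s2
  simp only [abs_zero, add_zero, zero_add] at s1 s2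
  refine (s1.trans s2).trans ((norm_integral_cexp_mul_ofReal_le hpq
    (M := D * (1 + 4 * K + 3 * K ^ 2) / m ^ 2) fun x hx => ?_).trans_eq (by ring))
  have hG := hgm x hx
  have hG0 : 0 < |g x| := hm.trans_le hG
  have D0 : 0 ≤ D := (abs_nonneg _).trans (hD x hx)
  have k1 : |g₁ x| ≤ K * |g x| ∧ |g₂ x| ≤ K * |g x| ∧ 0 ≤ K := by
    have K0 : 0 ≤ K := nonneg_of_mul_nonneg_left ((abs_nonneg _).trans (hK₁ x hx)) hm
    exact ⟨(hK₁ x hx).trans (by gcongr), (hK₂ x hx).trans (by gcongr), K0⟩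
  obtain ⟨k1, k2, K0⟩ := k1
  have m2 : 0 < m ^ 2 := by positivity
  have t1 : |w₂ x / g x ^ 2| ≤ D / m ^ 2 := by
    rw [abs_div, abs_pow]
    exact div_le_div₀ D0 (hD₂ x hx) m2 (by gcongr)
  have aux : ∀ r s : ℝ, |r| ≤ D → |s| ≤ K * |g x| → |r * s / g x ^ 3| ≤ K * D / m ^ 2 := by
    intro r s hr hs
    rw [abs_div, abs_mul, abs_pow]
    calc |r| * |s| / |g x| ^ 3 ≤ D * (K * |g x|) / |g x| ^ 3 := by gcongr
      _ = K * D / |g x| ^ 2 := by field_simp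
      _ ≤ K * D / m ^ 2 := by gcongr
  have t2 := aux _ _ (hD₁ x hx) k1
  have t3 := aux _ _ (hD x hx) k2
  have t4 : |w x * g₁ x ^ 2 / g x ^ 4| ≤ K ^ 2 * D / m ^ 2 := by
    rw [abs_div, abs_mul, abs_pow, abs_pow]
    calc |w x| * |g₁ x| ^ 2 / |g x| ^ 4 ≤ D * (K * |g x|) ^ 2 / |g x| ^ 4 := by
          gcongr
          exact hD x hx
      _ = K ^ 2 * D / |g x| ^ 2 := by field_simp
      _ ≤ K ^ 2 * D / m ^ 2 := by gcongr
  have e : U' x = w₂ x / g x ^ 2 - 3 * (w₁ x * g₁ x / g x ^ 3) - w x * g₂ x / g x ^ 3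
      + 3 * (w x * g₁ x ^ 2 / g x ^ 4) := by simp only [U']; ring
  have e' : D * (1 + 4 * K + 3 * K ^ 2) / m ^ 2
      = D / m ^ 2 + 3 * (K * D / m ^ 2) + K * D / m ^ 2 + 3 * (K ^ 2 * D / m ^ 2) := by ring
  rw [e, e']
  rw [abs_le] at t1 t2 t3 t4 ⊢
  constructor <;> linarith [t1.1, t1.2, t2.1, t2.2, t3.1, t3.2, t4.1, t4.2]

/-- The first derivative test of van der Corput, with an amplitude. -/
theorem norm_integral_cexp_le_of_first_deriv {φ g g₁ w w₁ : ℝ → ℝ} {p q : ℝ} (hpq : p ≤ q)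
    (hφ : ∀ x ∈ Icc p q, HasDerivAt φ (g x) x) (hg : ∀ x ∈ Icc p q, HasDerivAt g (g₁ x) x)
    (hg₁ : ContinuousOn g₁ (Icc p q)) (hw : ∀ x ∈ Icc p q, HasDerivAt w (w₁ x) x)
    (hw₁ : ContinuousOn w₁ (Icc p q)) {ρ D : ℝ} (hρ : 0 < ρ) (hg₁0 : ∀ x ∈ Icc p q, 0 ≤ g₁ x)
    (hgρ : (∀ x ∈ Icc p q, ρ ≤ g x) ∨ ∀ x ∈ Icc p q, g x ≤ -ρ)
    (hD : ∀ x ∈ Icc p q, |w x| ≤ D) (hD₁ : ∀ x ∈ Icc p q, |w₁ x| ≤ D) :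
    ‖∫ x in p..q, cexp (I * φ x) * (w x : ℂ)‖ ≤ D * (3 + (q - p)) / ρ := by
  have hu : uIcc p q = Icc p q := uIcc_of_le hpq
  have hgm : ∀ x ∈ Icc p q, ρ ≤ |g x| := fun x hx => by
    rcases hgρ with h | h
    · exact (h x hx).trans (le_abs_self _)
    · exact (le_neg_of_le_neg (h x hx)).trans (neg_le_abs _)
  have hg0 : ∀ x ∈ Icc p q, g x ≠ 0 := fun x hx => abs_pos.mp (hρ.trans_le (hgm x hx))
  have hp : p ∈ Icc p q := left_mem_Icc.mpr hpq
  have hq : q ∈ Icc p q := right_mem_Icc.mpr hpq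
  have D0 : 0 ≤ D := (abs_nonneg _).trans (hD p hp)
  have cont : ∀ {u u' : ℝ → ℝ}, (∀ x ∈ Icc p q, HasDerivAt u (u' x) x) →
      ContinuousOn u (Icc p q) := fun h x hx => (h x hx).continuousAt.continuousWithinAt
  set V : ℝ → ℝ := fun x => w x / g x
  set V' : ℝ → ℝ := fun x => (w₁ x * g x - w x * g₁ x) / g x ^ 2
  have hV : ∀ x ∈ Icc p q, HasDerivAt V (V' x) x := fun x hx =>
    (hw x hx).div (hg x hx) (hg0 x hx)
  have hV'c : ContinuousOn V' (Icc p q) := by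
    refine ContinuousOn.div ?_ ((cont hg).pow 2) fun x hx => pow_ne_zero 2 (hg0 x hx)
    exact (hw₁.mul (cont hg)).sub ((cont hw).mul hg₁)
  have s1 := norm_integral_cexp_mul_deriv_le (φ := φ) (g := g) (V := V) (V' := V') (p := p) (q := q)
    (by rwa [hu]) (by rwa [hu]) (by rw [hu]; exact cont hg) (by rwa [hu])
  have c1 : ∫ x in p..q, cexp (I * φ x) * ((g x * V x : ℝ) : ℂ)
      = ∫ x in p..q, cexp (I * φ x) * (w x : ℂ) := by
    refine intervalIntegral.integral_congr fun x hx => ?_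
    rw [hu] at hx
    simp only [V, mul_div_cancel₀ _ (hg0 x hx)]
  rw [c1] at s1
  have vb : ∀ x ∈ Icc p q, |V x| ≤ D / ρ := fun x hx => by
    simp only [V]
    rw [abs_div]
    exact div_le_div₀ D0 (hD x hx) hρ (hgm x hx)
  have hint : ContinuousOn (fun x => g₁ x / g x ^ 2) (Icc p q) :=
    hg₁.div ((cont hg).pow 2) fun x hx => pow_ne_zero 2 (hg0 x hx)
  have ftc : ∫ x in p..q, g₁ x / g x ^ 2 = -(g q)⁻¹ - -(g p)⁻¹ := by
    refine intervalIntegral.integral_eq_sub_of_hasDerivAt (f := fun x => -(g x)⁻¹) ?_ ?_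
    · intro x hx
      rw [hu] at hx
      refine ((hg x hx).inv (hg0 x hx)).neg.congr_deriv ?_
      ring
    · exact (hu.symm ▸ hint).intervalIntegrable
  have inv_le : -(g q)⁻¹ - -(g p)⁻¹ ≤ 1 / ρ := by
    rw [one_div]
    rcases hgρ with h | h
    · have h1 := inv_anti₀ hρ (h p hp)
      have h2 : 0 ≤ (g q)⁻¹ := inv_nonneg.mpr (hρ.le.trans (h q hq))
      linarith
    · have h1 := inv_anti₀ hρ (le_neg_of_le_neg (h q hq))
      have h2 : (g p)⁻¹ ≤ 0 := inv_nonpos.mpr ((h p hp).trans (by linarith))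
      rw [inv_neg] at h1
      linarith
  have s2 : ‖∫ x in p..q, cexp (I * φ x) * (V' x : ℂ)‖ ≤ D / ρ * (q - p) + D * (1 / ρ) := by
    calc ‖∫ x in p..q, cexp (I * φ x) * (V' x : ℂ)‖
        ≤ ∫ x in p..q, (D / ρ + D * (g₁ x / g x ^ 2)) := by
          refine intervalIntegral.norm_integral_le_of_norm_le hpq
            (Filter.Eventually.of_forall fun x hx => ?_) ?_
          · have hx' := Ioc_subset_Icc_self hx
            have h0 := hg0 x hx'
            rw [norm_mul, norm_exp_I_mul_ofReal, one_mul, norm_real, Real.norm_eq_abs]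
            have e : V' x = w₁ x / g x - w x * (g₁ x / g x ^ 2) := by
              simp only [V']; field_simp
            rw [e]
            refine (abs_sub _ _).trans (add_le_add ?_ ?_)
            · rw [abs_div]
              exact div_le_div₀ D0 (hD₁ x hx') hρ (hgm x hx')
            · have : 0 ≤ g₁ x / g x ^ 2 := div_nonneg (hg₁0 x hx') (sq_nonneg _)
              rw [abs_mul, abs_of_nonneg this]
              exact mul_le_mul_of_nonneg_right (hD x hx') this
          · exact (hu.symm ▸ (continuousOn_const.add (continuousOn_const.mul hint)) :
              ContinuousOn _ (uIcc p q)).intervalIntegrable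
      _ = D / ρ * (q - p) + D * (-(g q)⁻¹ - -(g p)⁻¹) := by
          rw [intervalIntegral.integral_add intervalIntegrable_const
            ((hu.symm ▸ hint : ContinuousOn _ (uIcc p q)).intervalIntegrable.const_mul _),
            intervalIntegral.integral_const_mul, ftc, intervalIntegral.integral_const, smul_eq_mul]
          ring
      _ ≤ _ := by gcongr
  have e : D * (3 + (q - p)) / ρ = D / ρ + D / ρ + (D / ρ * (q - p) + D * (1 / ρ)) := by ring
  rw [e]
  linarith [vb p hp, vb q hq]

/-- The second derivative test of van der Corput, with an amplitude. -/
theorem norm_integral_cexp_le_of_second_deriv {φ g g₁ w w₁ : ℝ → ℝ} {p q : ℝ} (hpq : p ≤ q)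
    (hφ : ∀ x ∈ Icc p q, HasDerivAt φ (g x) x) (hg : ∀ x ∈ Icc p q, HasDerivAt g (g₁ x) x)
    (hg₁ : ContinuousOn g₁ (Icc p q)) (hw : ∀ x ∈ Icc p q, HasDerivAt w (w₁ x) x)
    (hw₁ : ContinuousOn w₁ (Icc p q)) {m D : ℝ} (hm : 0 < m) (hgm : ∀ x ∈ Icc p q, m ≤ g₁ x)
    (hD : ∀ x ∈ Icc p q, |w x| ≤ D) (hD₁ : ∀ x ∈ Icc p q, |w₁ x| ≤ D) :
    ‖∫ x in p..q, cexp (I * φ x) * (w x : ℂ)‖ ≤ D * (8 + 2 * (q - p)) / √m := by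
  have hp : p ∈ Icc p q := left_mem_Icc.mpr hpq
  have hq : q ∈ Icc p q := right_mem_Icc.mpr hpq
  have D0 : 0 ≤ D := (abs_nonneg _).trans (hD p hp)
  have cont : ∀ {u u' : ℝ → ℝ}, (∀ x ∈ Icc p q, HasDerivAt u (u' x) x) →
      ContinuousOn u (Icc p q) := fun h x hx => (h x hx).continuousAt.continuousWithinAt
  have growth : ∀ x ∈ Icc p q, ∀ y ∈ Icc p q, x ≤ y → m * (y - x) ≤ g y - g x := by
    refine (convex_Icc p q).mul_sub_le_image_sub_of_le_deriv (cont hg) ?_ ?_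
    · exact fun x hx => (hg x (interior_subset hx)).differentiableAt.differentiableWithinAt
    · exact fun x hx => (hg x (interior_subset hx)).deriv ▸ hgm x (interior_subset hx)
  -- `c` is the stationary point, or the end point closest to it
  obtain ⟨c, hc, hcr, hcl⟩ : ∃ c ∈ Icc p q, (∀ x ∈ Icc p q, c < x → m * (x - c) ≤ g x) ∧
      ∀ x ∈ Icc p q, x < c → g x ≤ -(m * (c - x)) := by
    by_cases h1 : 0 ≤ g p
    · refine ⟨p, hp, fun x hx h => ?_, fun x hx h => absurd hx.1 h.not_ge⟩
      linarith [growth p hp x hx h.le]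
    by_cases h2 : g q ≤ 0
    · refine ⟨q, hq, fun x hx h => absurd hx.2 h.not_ge, fun x hx h => ?_⟩
      linarith [growth x hx q hq h.le]
    obtain ⟨c, hc, hc0⟩ := intermediate_value_Icc hpq (cont hg)
      (show (0 : ℝ) ∈ Icc (g p) (g q) from ⟨(not_le.mp h1).le, (not_le.mp h2).le⟩)
    refine ⟨c, hc, fun x hx h => ?_, fun x hx h => ?_⟩
    · linarith [growth c hc x hx h.le]
    · linarith [growth x hx c hc h.le]
  have hs : 0 < √m := Real.sqrt_pos.mpr hm
  set ε : ℝ := 1 / √m with hε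
  have hε0 : 0 < ε := by positivity
  have hmε : m * ε = √m := by
    rw [hε, mul_one_div, div_eq_iff hs.ne']
    exact (Real.mul_self_sqrt hm.le).symm
  set c₁ := max p (c - ε) with hc₁
  set c₂ := min q (c + ε) with hc₂
  have o1 : p ≤ c₁ := le_max_left _ _
  have o2 : c₁ ≤ c := max_le hc.1 (by linarith)
  have o3 : c ≤ c₂ := le_min hc.2 (by linarith)
  have o4 : c₂ ≤ q := min_le_left _ _
  have hcexp : ContinuousOn (fun x => cexp (I * φ x) * (w x : ℂ)) (Icc p q) :=
    ((continuous_exp.comp_continuousOn (continuousOn_const.mul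
      (continuous_ofReal.comp_continuousOn (cont hφ))))).mul
      (continuous_ofReal.comp_continuousOn (cont hw))
  have hii : ∀ r s, p ≤ r → r ≤ s → s ≤ q →
      IntervalIntegrable (fun x => cexp (I * φ x) * (w x : ℂ)) volume r s := fun r s h1 h2 h3 =>
    ((uIcc_of_le h2).symm ▸ hcexp.mono (Icc_subset_Icc h1 h3) :
      ContinuousOn _ (uIcc r s)).intervalIntegrable
  have piece : ∀ r s, p ≤ r → r ≤ s → s ≤ q →
      ((∀ x ∈ Icc r s, √m ≤ g x) ∨ ∀ x ∈ Icc r s, g x ≤ -√m) →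
      ‖∫ x in r..s, cexp (I * φ x) * (w x : ℂ)‖ ≤ D * (3 + (q - p)) / √m := by
    intro r s h1 h2 h3 h
    have sub : ∀ x ∈ Icc r s, x ∈ Icc p q := fun x hx => Icc_subset_Icc h1 h3 hx
    refine (norm_integral_cexp_le_of_first_deriv h2 (fun x hx => hφ x (sub x hx))
      (fun x hx => hg x (sub x hx)) (hg₁.mono sub) (fun x hx => hw x (sub x hx)) (hw₁.mono sub) hs
      (fun x hx => hm.le.trans (hgm x (sub x hx))) h (fun x hx => hD x (sub x hx))
      fun x hx => hD₁ x (sub x hx)).trans ?_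
    gcongr
  have b1 : ‖∫ x in p..c₁, cexp (I * φ x) * (w x : ℂ)‖ ≤ D * (3 + (q - p)) / √m := by
    rcases le_total (c - ε) p with h | h
    · rw [hc₁, max_eq_left h, intervalIntegral.integral_same, norm_zero]
      have : 0 ≤ q - p := sub_nonneg.mpr hpq
      positivity
    · refine piece p c₁ le_rfl o1 (o2.trans hc.2) (Or.inr fun x hx => ?_)
      rw [hc₁, max_eq_right h] at hx
      have := hcl x ⟨hx.1, by linarith [hx.2, hc.2]⟩ (by linarith [hx.2])
      have h3 : m * ε ≤ m * (c - x) := by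
        have := hx.2
        gcongr
        linarith
      linarith
  have b3 : ‖∫ x in c₂..q, cexp (I * φ x) * (w x : ℂ)‖ ≤ D * (3 + (q - p)) / √m := by
    rcases le_total q (c + ε) with h | h
    · rw [hc₂, min_eq_left h, intervalIntegral.integral_same, norm_zero]
      have : 0 ≤ q - p := sub_nonneg.mpr hpq
      positivity
    · refine piece c₂ q (hc.1.trans o3) o4 le_rfl (Or.inl fun x hx => ?_)
      rw [hc₂, min_eq_right h] at hx
      have := hcr x ⟨by linarith [hx.1, hc.1], hx.2⟩ (by linarith [hx.1])
      have h3 : m * ε ≤ m * (x - c) := by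
        have := hx.1
        gcongr
        linarith
      linarith
  have b2 : ‖∫ x in c₁..c₂, cexp (I * φ x) * (w x : ℂ)‖ ≤ D * (2 * ε) := by
    refine (norm_integral_cexp_mul_ofReal_le (o2.trans o3) (M := D) fun x hx =>
      hD x ⟨o1.trans hx.1, hx.2.trans o4⟩).trans ?_
    have h1 : c - ε ≤ c₁ := le_max_right _ _
    have h2 : c₂ ≤ c + ε := min_le_right _ _
    gcongr
    linarith
  have split : ∫ x in p..q, cexp (I * φ x) * (w x : ℂ)
      = (∫ x in p..c₁, cexp (I * φ x) * (w x : ℂ)) + (∫ x in c₁..c₂, cexp (I * φ x) * (w x : ℂ))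
        + ∫ x in c₂..q, cexp (I * φ x) * (w x : ℂ) := by
    rw [intervalIntegral.integral_add_adjacent_intervals (hii _ _ le_rfl o1 (o2.trans hc.2))
      (hii _ _ o1 (o2.trans o3) o4), intervalIntegral.integral_add_adjacent_intervals
      (hii _ _ le_rfl (o1.trans (o2.trans o3)) o4) (hii _ _ (hc.1.trans o3) o4 le_rfl)]
  rw [split]
  have e : D * (8 + 2 * (q - p)) / √m
      = D * (3 + (q - p)) / √m + D * (2 * ε) + D * (3 + (q - p)) / √m := by
    rw [hε]; ring
  rw [e]
  exact (norm_add_le _ _).trans (add_le_add ((norm_add_le _ _).trans (add_le_add b1 b2)) b3)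

/-- The second derivative test for a phase whose second derivative may have either sign. -/
theorem norm_integral_cexp_le_of_abs_second_deriv {φ g g₁ w w₁ : ℝ → ℝ} {p q : ℝ} (hpq : p ≤ q)
    (hφ : ∀ x ∈ Icc p q, HasDerivAt φ (g x) x) (hg : ∀ x ∈ Icc p q, HasDerivAt g (g₁ x) x)
    (hg₁ : ContinuousOn g₁ (Icc p q)) (hw : ∀ x ∈ Icc p q, HasDerivAt w (w₁ x) x)
    (hw₁ : ContinuousOn w₁ (Icc p q)) {m D : ℝ} (hm : 0 < m)
    (hgm : (∀ x ∈ Icc p q, m ≤ g₁ x) ∨ ∀ x ∈ Icc p q, m ≤ -g₁ x)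
    (hD : ∀ x ∈ Icc p q, |w x| ≤ D) (hD₁ : ∀ x ∈ Icc p q, |w₁ x| ≤ D) :
    ‖∫ x in p..q, cexp (I * φ x) * (w x : ℂ)‖ ≤ D * (8 + 2 * (q - p)) / √m := by
  rcases hgm with h | h
  · exact norm_integral_cexp_le_of_second_deriv hpq hφ hg hg₁ hw hw₁ hm h hD hD₁
  · have key := norm_integral_cexp_le_of_second_deriv (φ := fun x => -φ x) hpq
      (fun x hx => (hφ x hx).neg) (fun x hx => (hg x hx).neg) hg₁.neg hw hw₁ hm h hD hD₁
    refine le_trans (le_of_eq ?_) key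
    rw [← RCLike.norm_conj, ← intervalIntegral.intervalIntegral_conj]
    congr 1
    refine intervalIntegral.integral_congr fun x _ => ?_
    simp only [map_mul, ← exp_conj, conj_I, conj_ofReal]
    push_cast
    ring_nf

end Oscillatory

/-! ### The kernel of `e^{iτ|D|^a}` at unit frequency -/

section Kernel

open Complex Set

/-- The weight `((η - p)(q - η))²`, positive inside `(p, q)` and vanishing to second order at the
end points. -/
def quarticBump (p q η : ℝ) : ℝ := ((η - p) * (q - η)) ^ 2

theorem continuous_quarticBump (p q : ℝ) : Continuous (quarticBump p q) := by
  unfold quarticBump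
  fun_prop

theorem hasDerivAt_quarticBump (p q x : ℝ) :
    HasDerivAt (quarticBump p q) (2 * ((x - p) * (q - x)) * (p + q - 2 * x)) x := by
  have h := ((((hasDerivAt_id x).sub_const p).mul ((hasDerivAt_id x).const_sub q)).pow 2)
  refine h.congr_deriv ?_
  simp only [Pi.mul_apply, id]
  push_cast
  ring

theorem hasDerivAt_deriv_quarticBump (p q x : ℝ) :
    HasDerivAt (fun x => 2 * ((x - p) * (q - x)) * (p + q - 2 * x))
      (2 * (p + q - 2 * x) ^ 2 - 4 * ((x - p) * (q - x))) x := by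
  have h := (((((hasDerivAt_id x).sub_const p).mul ((hasDerivAt_id x).const_sub q)).const_mul
    2).mul (((hasDerivAt_id x).const_mul 2).const_sub (p + q)))
  refine h.congr_deriv ?_
  simp
  ring

/-- The kernel of `e^{iτ|D|^a}` localised to frequencies in `(p, q)` by the bump weight. -/
noncomputable def oscKernel (a p q X τ : ℝ) : ℂ :=
  ∫ η in p..q, cexp (I * ((X * η + τ * η ^ a : ℝ) : ℂ)) * (quarticBump p q η : ℂ)

theorem hasDerivAt_phase {a x : ℝ} (X τ : ℝ) (hx : x ≠ 0) :
    HasDerivAt (fun η => X * η + τ * η ^ a) (X + τ * a * x ^ (a - 1)) x := by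
  have h := ((hasDerivAt_id x).const_mul X).add
    ((Real.hasDerivAt_rpow_const (p := a) (Or.inl hx)).const_mul τ)
  refine h.congr_deriv ?_
  ring

theorem hasDerivAt_const_mul_rpow {x : ℝ} (c e : ℝ) (hx : x ≠ 0) :
    HasDerivAt (fun η => c * η ^ e) (c * e * x ^ (e - 1)) x := by
  refine ((Real.hasDerivAt_rpow_const (p := e) (Or.inl hx)).const_mul c).congr_deriv ?_
  ring

theorem exists_rpow_bounds {p q : ℝ} (hp : 0 < p) (e : ℝ) :
    ∃ D : ℝ, 1 ≤ D ∧ ∀ x ∈ Icc p q, x ^ e ≤ D := by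
  have hc : ContinuousOn (fun x : ℝ => x ^ e) (Icc p q) := fun x hx =>
    (Real.continuousAt_rpow_const x e (Or.inl (hp.trans_le hx.1).ne')).continuousWithinAt
  obtain ⟨D, hD⟩ := isCompact_Icc.exists_bound_of_continuousOn hc
  exact ⟨max 1 D, le_max_left _ _, fun x hx =>
    (le_abs_self _).trans ((hD x hx).trans (le_max_right _ _))⟩

theorem exists_quarticBump_bounds {p q : ℝ} :
    ∃ D : ℝ, 0 < D ∧ (∀ x ∈ Icc p q, |quarticBump p q x| ≤ D) ∧
      (∀ x ∈ Icc p q, |2 * ((x - p) * (q - x)) * (p + q - 2 * x)| ≤ D) ∧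
      ∀ x ∈ Icc p q, |2 * (p + q - 2 * x) ^ 2 - 4 * ((x - p) * (q - x))| ≤ D := by
  obtain ⟨D₀, h0⟩ := (isCompact_Icc (a := p) (b := q)).exists_bound_of_continuousOn
    (f := quarticBump p q) (continuous_quarticBump p q).continuousOn
  obtain ⟨D₁, h1⟩ := (isCompact_Icc (a := p) (b := q)).exists_bound_of_continuousOn
    (f := fun x => 2 * ((x - p) * (q - x)) * (p + q - 2 * x)) (by fun_prop)
  obtain ⟨D₂, h2⟩ := (isCompact_Icc (a := p) (b := q)).exists_bound_of_continuousOn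
    (f := fun x => 2 * (p + q - 2 * x) ^ 2 - 4 * ((x - p) * (q - x))) (by fun_prop)
  refine ⟨max 1 (max D₀ (max D₁ D₂)), by positivity, fun x hx => (h0 x hx).trans ?_,
    fun x hx => (h1 x hx).trans ?_, fun x hx => (h2 x hx).trans ?_⟩
  · simp
  · simp
  · simp

theorem norm_oscKernel_le {a p q D : ℝ} (hpq : p ≤ q) (hD : ∀ x ∈ Icc p q, |quarticBump p q x| ≤ D)
    (X τ : ℝ) : ‖oscKernel a p q X τ‖ ≤ D * (q - p) :=
  norm_integral_cexp_mul_ofReal_le (φ := fun η => X * η + τ * η ^ a) hpq hD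

/-- Dispersive decay of the kernel, from the second derivative of the phase. -/
theorem exists_norm_oscKernel_le_time {a p q : ℝ} (ha0 : 0 < a) (ha1 : a ≠ 1) (hp : 0 < p)
    (hpq : p ≤ q) :
    ∃ C : ℝ, 0 < C ∧ ∀ X τ : ℝ, τ ≠ 0 → ‖oscKernel a p q X τ‖ ≤ C / √|τ| := by
  obtain ⟨E, hE1, hE⟩ := exists_rpow_bounds (q := q) hp (2 - a)
  obtain ⟨D, hD0, hD, hD₁, -⟩ := exists_quarticBump_bounds (p := p) (q := q)
  have hx0 : ∀ x ∈ Icc p q, 0 < x := fun x hx => hp.trans_le hx.1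
  have hE' : ∀ x ∈ Icc p q, E⁻¹ ≤ x ^ (a - 1 - 1) := by
    intro x hx
    have h := inv_anti₀ (Real.rpow_pos_of_pos (hx0 x hx) (2 - a)) (hE x hx)
    rwa [← Real.rpow_neg (hx0 x hx).le, show -(2 - a) = a - 1 - 1 by ring] at h
  set c : ℝ := a * |a - 1| * E⁻¹ with hc
  have hc0 : 0 < c := by
    have : 0 < |a - 1| := abs_pos.mpr (sub_ne_zero.mpr ha1)
    positivity
  have hqp : 0 ≤ q - p := sub_nonneg.mpr hpq
  refine ⟨D * (8 + 2 * (q - p)) / √c, by positivity, fun X τ hτ => ?_⟩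
  have hτ0 : 0 < |τ| := abs_pos.mpr hτ
  have e : D * (8 + 2 * (q - p)) / √c / √|τ| = D * (8 + 2 * (q - p)) / √(c * |τ|) := by
    rw [Real.sqrt_mul hc0.le, div_div]
  rw [e]
  refine norm_integral_cexp_le_of_abs_second_deriv (φ := fun η => X * η + τ * η ^ a)
    (g := fun x => X + τ * a * x ^ (a - 1)) (g₁ := fun x => τ * a * (a - 1) * x ^ (a - 1 - 1)) hpq
    (fun x hx => hasDerivAt_phase X τ (hx0 x hx).ne')
    (fun x hx => (hasDerivAt_const_mul_rpow _ _ (hx0 x hx).ne').const_add X)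
    (fun x hx => (hasDerivAt_const_mul_rpow _ _ (hx0 x hx).ne').continuousAt.continuousWithinAt)
    (fun x _ => hasDerivAt_quarticBump p q x) (by fun_prop) (by positivity) ?_ hD hD₁
  have lower : ∀ s : ℝ, |s| = 1 → s * (τ * (a - 1)) = |τ * (a - 1)| → ∀ x ∈ Icc p q,
      c * |τ| ≤ s * (τ * a * (a - 1) * x ^ (a - 1 - 1)) := by
    intro s _ hs x hx
    calc c * |τ| = a * |τ * (a - 1)| * E⁻¹ := by rw [hc, abs_mul]; ring
      _ ≤ a * |τ * (a - 1)| * x ^ (a - 1 - 1) := by gcongr; exact hE' x hx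
      _ = _ := by rw [← hs]; ring
  rcases le_total 0 (τ * (a - 1)) with h | h
  · left
    simpa using lower 1 (by simp) (by rw [abs_of_nonneg h, one_mul])
  · right
    simpa using lower (-1) (by simp) (by rw [abs_of_nonpos h]; ring)

/-- Rapid decay of the kernel outside of the region `|X| ≲ |τ|` containing the stationary points. -/
theorem exists_norm_oscKernel_le_space {a p q : ℝ} (ha0 : 0 < a) (hp : 0 < p) (hpq : p ≤ q) :
    ∃ C C₀ : ℝ, 0 < C ∧ 0 < C₀ ∧ ∀ X τ : ℝ, C₀ * |τ| ≤ |X| →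
      ‖oscKernel a p q X τ‖ ≤ C / (1 + |X|) ^ 2 := by
  obtain ⟨E₁, hE₁1, hE₁⟩ := exists_rpow_bounds (q := q) hp (a - 1)
  obtain ⟨E₂, hE₂1, hE₂⟩ := exists_rpow_bounds (q := q) hp (a - 1 - 1)
  obtain ⟨E₃, hE₃1, hE₃⟩ := exists_rpow_bounds (q := q) hp (a - 1 - 1 - 1)
  obtain ⟨D, hD0, hD, hD₁, hD₂⟩ := exists_quarticBump_bounds (p := p) (q := q)
  have hx0 : ∀ x ∈ Icc p q, 0 < x := fun x hx => hp.trans_le hx.1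
  have hqp : 0 ≤ q - p := sub_nonneg.mpr hpq
  set C₀ : ℝ := 2 * a * E₁ with hC₀
  have hC₀0 : 0 < C₀ := by positivity
  set K : ℝ := (a * |a - 1| * E₂ + a * |a - 1| * |a - 1 - 1| * E₃) * (2 / C₀) with hK
  have hK0 : 0 ≤ K := by positivity
  set C : ℝ := 16 * (D * (1 + 4 * K + 3 * K ^ 2) * (q - p)) + 4 * (D * (q - p)) + 1 with hC
  refine ⟨C, C₀, by positivity, hC₀0, fun X τ hXτ => ?_⟩
  rw [le_div_iff₀ (by positivity)]
  rcases le_total |X| 1 with hX | hX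
  · calc ‖oscKernel a p q X τ‖ * (1 + |X|) ^ 2 ≤ D * (q - p) * (1 + 1) ^ 2 := by
          gcongr
          exact norm_oscKernel_le hpq hD X τ
      _ ≤ C := by
          have : 0 ≤ D * (1 + 4 * K + 3 * K ^ 2) * (q - p) := by positivity
          rw [hC]; linarith
  · set m : ℝ := |X| / 2 with hm
    have hm0 : 0 < m := by positivity
    have hτm : |τ| ≤ 2 / C₀ * m := by
      rw [hm, div_mul_div_comm, le_div_iff₀ (by positivity)]
      linarith
    have key := norm_integral_cexp_le_of_nonstationary (φ := fun η => X * η + τ * η ^ a)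
      (g := fun x => X + τ * a * x ^ (a - 1)) (g₁ := fun x => τ * a * (a - 1) * x ^ (a - 1 - 1))
      (g₂ := fun x => τ * a * (a - 1) * (a - 1 - 1) * x ^ (a - 1 - 1 - 1)) (w := quarticBump p q)
      (m := m) (K := K) (D := D) hpq
      (fun x hx => hasDerivAt_phase X τ (hx0 x hx).ne')
      (fun x hx => (hasDerivAt_const_mul_rpow _ _ (hx0 x hx).ne').const_add X)
      (fun x hx => hasDerivAt_const_mul_rpow _ _ (hx0 x hx).ne')
      (fun x hx => (hasDerivAt_const_mul_rpow _ _ (hx0 x hx).ne').continuousAt.continuousWithinAt)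
      (fun x _ => hasDerivAt_quarticBump p q x) (fun x _ => hasDerivAt_deriv_quarticBump p q x)
      (by fun_prop) (by simp [quarticBump]) (by simp [quarticBump]) (by simp) (by simp) hm0 ?_ ?_ ?_
      hD hD₁ hD₂
    · calc ‖oscKernel a p q X τ‖ * (1 + |X|) ^ 2
          ≤ D * (1 + 4 * K + 3 * K ^ 2) * (q - p) / m ^ 2 * (|X| + |X|) ^ 2 := by
            gcongr
            exact key
        _ = 16 * (D * (1 + 4 * K + 3 * K ^ 2) * (q - p)) := by rw [hm]; field_simp; ring
        _ ≤ C := by rw [hC]; linarith [mul_nonneg hD0.le hqp]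
    · intro x hx
      have h1 : |τ * a * x ^ (a - 1)| ≤ m := by
        rw [abs_mul, abs_mul, abs_of_pos ha0, abs_of_pos (Real.rpow_pos_of_pos (hx0 x hx) _)]
        calc |τ| * a * x ^ (a - 1) ≤ |τ| * a * E₁ := by gcongr; exact hE₁ x hx
          _ = C₀ * |τ| / 2 := by rw [hC₀]; ring
          _ ≤ m := by rw [hm]; linarith
      have h2 := abs_sub_abs_le_abs_sub X (-(τ * a * x ^ (a - 1)))
      rw [sub_neg_eq_add, abs_neg] at h2
      have h3 : |X| = 2 * m := by rw [hm]; ring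
      linarith
    · intro x hx
      have := hx0 x hx
      rw [abs_mul, abs_mul, abs_mul, abs_of_pos ha0, abs_of_pos (Real.rpow_pos_of_pos (hx0 x hx) _)]
      calc |τ| * a * |a - 1| * x ^ (a - 1 - 1) ≤ (2 / C₀ * m) * a * |a - 1| * E₂ := by
            gcongr; exact hE₂ x hx
        _ = (a * |a - 1| * E₂ + 0) * (2 / C₀) * m := by ring
        _ ≤ K * m := by rw [hK]; gcongr; positivity
    · intro x hx
      have := hx0 x hx
      rw [abs_mul, abs_mul, abs_mul, abs_mul, abs_of_pos ha0,
        abs_of_pos (Real.rpow_pos_of_pos (hx0 x hx) _)]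
      calc |τ| * a * |a - 1| * |a - 1 - 1| * x ^ (a - 1 - 1 - 1)
          ≤ (2 / C₀ * m) * a * |a - 1| * |a - 1 - 1| * E₃ := by
            gcongr; exact hE₃ x hx
        _ = (0 + a * |a - 1| * |a - 1 - 1| * E₃) * (2 / C₀) * m := by ring
        _ ≤ K * m := by rw [hK]; gcongr; positivity

/-- The two regimes of the kernel: decay `|X|^{-1/2}` everywhere, uniformly in time, and integrable
decay off the region `|X| ≲ |τ|`. -/
theorem exists_norm_oscKernel_le {a p q : ℝ} (ha0 : 0 < a) (ha1 : a ≠ 1) (hp : 0 < p)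
    (hpq : p ≤ q) :
    ∃ C C₀ : ℝ, 0 < C ∧ 0 < C₀ ∧ (∀ X τ : ℝ, ‖oscKernel a p q X τ‖ ≤ C / √(1 + |X|)) ∧
      ∀ X τ : ℝ, C₀ * |τ| ≤ |X| → ‖oscKernel a p q X τ‖ ≤ C / (1 + |X|) ^ 2 := by
  obtain ⟨C₁, C₀, hC₁, hC₀, h1⟩ := exists_norm_oscKernel_le_space (a := a) ha0 hp hpq
  obtain ⟨C₂, hC₂, h2⟩ := exists_norm_oscKernel_le_time ha0 ha1 hp hpq
  obtain ⟨D, hD0, hD, -, -⟩ := exists_quarticBump_bounds (p := p) (q := q)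
  have hqp : 0 ≤ q - p := sub_nonneg.mpr hpq
  refine ⟨C₁ + C₂ * √(2 * C₀) + 2 * (D * (q - p)), C₀, by positivity, hC₀, fun X τ => ?_,
    fun X τ h => (h1 X τ h).trans ?_⟩
  · have hs : 0 < √(1 + |X|) := Real.sqrt_pos.mpr (by positivity)
    have hs1 : 1 ≤ √(1 + |X|) := Real.one_le_sqrt.mpr (by simp)
    rw [le_div_iff₀ hs]
    rcases le_total (C₀ * |τ|) |X| with h | h
    · have : √(1 + |X|) ≤ (1 + |X|) ^ 2 := by
        calc √(1 + |X|) ≤ √(1 + |X|) ^ 4 := le_self_pow₀ hs1 (by norm_num)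
          _ = (√(1 + |X|) ^ 2) ^ 2 := by ring
          _ = (1 + |X|) ^ 2 := by rw [Real.sq_sqrt (by positivity)]
      have h3 := h1 X τ h
      rw [le_div_iff₀ (by positivity)] at h3
      calc ‖oscKernel a p q X τ‖ * √(1 + |X|) ≤ ‖oscKernel a p q X τ‖ * (1 + |X|) ^ 2 := by gcongr
        _ ≤ C₁ + 0 + 0 := by linarith
        _ ≤ _ := by gcongr <;> positivity
    · rcases le_total |X| 1 with hX | hX
      · have : √(1 + |X|) ≤ 2 := by
          rw [Real.sqrt_le_left (by norm_num)]
          linarith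
        calc ‖oscKernel a p q X τ‖ * √(1 + |X|) ≤ D * (q - p) * 2 := by
              gcongr
              exact norm_oscKernel_le hpq hD X τ
          _ = 0 + 0 + 2 * (D * (q - p)) := by ring
          _ ≤ _ := by gcongr; positivity
      · have hτ0 : 0 < |τ| := by
          have : 0 < C₀ * |τ| := by linarith
          exact pos_of_mul_pos_right this hC₀.le
        have h3 := h2 X τ (abs_pos.mp hτ0)
        have h4 : √(1 + |X|) ≤ √(2 * C₀) * √|τ| := by
          rw [← Real.sqrt_mul (by positivity)]
          exact Real.sqrt_le_sqrt (by linarith)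
        have hst : 0 < √|τ| := Real.sqrt_pos.mpr hτ0
        calc ‖oscKernel a p q X τ‖ * √(1 + |X|) ≤ C₂ / √|τ| * (√(2 * C₀) * √|τ|) := by gcongr
          _ = 0 + C₂ * √(2 * C₀) + 0 := by field_simp; ring
          _ ≤ _ := by gcongr; positivity
  · gcongr
    have : 0 ≤ C₂ * √(2 * C₀) := by positivity
    have : 0 ≤ D * (q - p) := by positivity
    linarith

/-- An integrable majorant of the kernel, valid as long as `|X| ≤ M` or `|τ| ≲ M`. -/
noncomputable def kernelMajorant (M X : ℝ) : ℝ :=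
  (Icc (-M) M).indicator (fun X => 1 / √(1 + |X|)) X + 1 / (1 + |X|) ^ 2

theorem kernelMajorant_nonneg (M X : ℝ) : 0 ≤ kernelMajorant M X :=
  add_nonneg (indicator_nonneg (fun _ _ => by positivity) _) (by positivity)

theorem kernelMajorant_le_two (M X : ℝ) : kernelMajorant M X ≤ 2 := by
  have h1 : (Icc (-M) M).indicator (fun X => 1 / √(1 + |X|)) X ≤ 1 := by
    refine indicator_le_self' (fun _ _ => by positivity) X |>.trans ?_
    rw [div_le_one (Real.sqrt_pos.mpr (by positivity))]
    exact Real.one_le_sqrt.mpr (by simp)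
  have h2 : 1 / (1 + |X|) ^ 2 ≤ 1 := by
    rw [div_le_one (by positivity)]
    exact one_le_pow₀ (by simp)
  unfold kernelMajorant
  linarith

theorem kernelMajorant_neg (M X : ℝ) : kernelMajorant M (-X) = kernelMajorant M X := by
  have : (-X ∈ Icc (-M) M) ↔ X ∈ Icc (-M) M := by
    simp only [mem_Icc]
    constructor <;> rintro ⟨h1, h2⟩ <;> constructor <;> linarith
  by_cases h : X ∈ Icc (-M) M
  · simp [kernelMajorant, h, this.mpr h]
  · simp [kernelMajorant, h, mt this.mp h]

theorem measurable_kernelMajorant (M : ℝ) : Measurable (kernelMajorant M) := by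
  unfold kernelMajorant
  refine Measurable.add (Measurable.indicator ?_ measurableSet_Icc) ?_ <;> fun_prop

theorem integrable_inv_one_add_abs_sq :
    Integrable (fun X : ℝ => 1 / (1 + |X|) ^ 2) ∧ ∫ X : ℝ, 1 / (1 + |X|) ^ 2 ≤ 4 := by
  have hle : ∀ X : ℝ, 1 / (1 + |X|) ^ 2 ≤ (1 + X ^ 2)⁻¹ := fun X => by
    rw [one_div]
    refine inv_anti₀ (by positivity) ?_
    nlinarith [sq_abs X, abs_nonneg X]
  have hi : Integrable (fun X : ℝ => 1 / (1 + |X|) ^ 2) := by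
    refine integrable_inv_one_add_sq.mono' (Measurable.aestronglyMeasurable (by fun_prop))
      (Filter.Eventually.of_forall fun X => ?_)
    rw [Real.norm_of_nonneg (by positivity)]
    exact hle X
  refine ⟨hi, (integral_mono hi integrable_inv_one_add_sq hle).trans ?_⟩
  rw [integral_univ_inv_one_add_sq]
  exact Real.pi_le_four

theorem integral_inv_sqrt_one_add_abs_le {M : ℝ} (hM : 0 ≤ M) :
    ∫ X in Icc (-M) M, 1 / √(1 + |X|) ≤ 4 * √(1 + M) := by
  have hc : Continuous fun X : ℝ => 1 / √(1 + |X|) := by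
    refine continuous_const.div (by fun_prop) fun X => ?_
    exact (Real.sqrt_pos.mpr (by positivity)).ne'
  rw [integral_Icc_eq_integral_Ioc, ← intervalIntegral.integral_of_le (by linarith)]
  have half : ∫ X in (0 : ℝ)..M, 1 / √(1 + |X|) = 2 * √(1 + M) - 2 * √(1 + 0) := by
    refine intervalIntegral.integral_eq_sub_of_hasDerivAt (f := fun X => 2 * √(1 + X)) ?_
      (hc.intervalIntegrable _ _)
    intro X hX
    rw [uIcc_of_le hM] at hX
    rw [abs_of_nonneg hX.1]
    have h0 : (1 + X) ≠ 0 := by linarith [hX.1]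
    refine ((((hasDerivAt_id X).const_add 1).sqrt h0).const_mul 2).congr_deriv ?_
    simp only [id]
    ring
  have other : ∫ X in (-M)..0, 1 / √(1 + |X|) = ∫ X in (0 : ℝ)..M, 1 / √(1 + |X|) := by
    have := intervalIntegral.integral_comp_neg (a := 0) (b := M) (fun X : ℝ => 1 / √(1 + |X|))
    simp only [abs_neg, neg_zero] at this
    exact this.symm
  rw [← intervalIntegral.integral_add_adjacent_intervals (b := 0) (hc.intervalIntegrable _ _)
    (hc.intervalIntegrable _ _), other, half]
  have : 0 ≤ √((1 : ℝ) + 0) := Real.sqrt_nonneg _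
  linarith

theorem integrable_kernelMajorant {M : ℝ} (hM : 0 ≤ M) :
    Integrable (kernelMajorant M) ∧ ∫ X, kernelMajorant M X ≤ 4 * √(1 + M) + 4 := by
  have hc : Continuous fun X : ℝ => 1 / √(1 + |X|) := by
    refine continuous_const.div (by fun_prop) fun X => ?_
    exact (Real.sqrt_pos.mpr (by positivity)).ne'
  have i1 : Integrable ((Icc (-M) M).indicator (fun X => 1 / √(1 + |X|))) :=
    (hc.integrableOn_Icc).integrable_indicator measurableSet_Icc
  have i2 := integrable_inv_one_add_abs_sq
  refine ⟨i1.add i2.1, ?_⟩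
  unfold kernelMajorant
  rw [integral_add i1 i2.1, integral_indicator measurableSet_Icc]
  exact add_le_add (integral_inv_sqrt_one_add_abs_le hM) i2.2

end Kernel

/-! ### The maximal estimate at unit frequency -/

section Maximal

open Complex Set ComplexConjugate Function

/-- The solution `∫_b^B e^{i(xη + τη^a)} G(η) dη` with frequencies in `[b, B]`. -/
noncomputable def oscOp (a b B : ℝ) (G : ℝ → ℂ) (x τ : ℝ) : ℂ :=
  ∫ η in Icc b B, cexp (I * ((x * η + τ * η ^ a : ℝ) : ℂ)) * G η

theorem continuous_oscOp {a b B : ℝ} {G : ℝ → ℂ} (hG : Integrable G (volume.restrict (Icc b B))) :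
    Continuous (uncurry (oscOp a b B G)) := by
  refine continuous_of_dominated (bound := fun η => ‖G η‖) (fun z => ?_) (fun z => ?_) hG.norm ?_
  · refine AEStronglyMeasurable.mul ?_ hG.1
    exact Measurable.aestronglyMeasurable (by fun_prop)
  · refine Filter.Eventually.of_forall fun η => ?_
    rw [norm_mul, norm_exp_I_mul_ofReal, one_mul]
  · exact Filter.Eventually.of_forall fun η => by fun_prop

/-- The function `√(quarticBump)`, extended by zero. -/
noncomputable def sqrtBump (p q η : ℝ) : ℝ := max 0 ((η - p) * (q - η))

theorem sqrtBump_eq {p q η : ℝ} (h : η ∈ Icc p q) : sqrtBump p q η = (η - p) * (q - η) :=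
  max_eq_right (mul_nonneg (sub_nonneg.mpr h.1) (sub_nonneg.mpr h.2))

theorem sqrtBump_le (p q η : ℝ) : sqrtBump p q η ≤ (q - p) ^ 2 :=
  max_le (sq_nonneg _) (by nlinarith [sq_nonneg (η - p), sq_nonneg (q - η)])

/-- The `T T*` bound for the linearised operator `G ↦ oscOp G x (τ x)`, uniformly in the measurable
choice `τ` of the time. -/
theorem exists_oscOp_linearised_bound {a b B : ℝ} (ha0 : 0 < a) (ha1 : a ≠ 1) (hb : 0 < b)
    (hbB : b ≤ B) :
    ∃ C : ℝ, 0 < C ∧ ∀ M : ℝ, 1 ≤ M → ∀ ρ N : ℝ, (N ≤ M ∨ ρ ≤ M) →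
      ∀ G : ℝ → ℂ, MemLp G 2 (volume.restrict (Icc b B)) →
      ∀ τ : ℝ → ℝ, Measurable τ → (∀ x, τ x ∈ Icc 0 N) →
        ∫⁻ x in Metric.ball (0 : ℝ) ρ, ‖oscOp a b B G x (τ x)‖ₑ ^ 2
          ≤ ENNReal.ofReal (C * √M) * ∫⁻ η in Icc b B, ‖G η‖ₑ ^ 2 := by
  have hB : 0 < B := hb.trans_le hbB
  -- the bump lives on a larger interval, so as to be bounded below on `[b, B]`
  set p : ℝ := b / 2 with hp
  set q : ℝ := 2 * B with hq
  have hp0 : 0 < p := by positivity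
  have hpq : p ≤ q := by rw [hp, hq]; linarith
  obtain ⟨C₁, C₀, hC₁, hC₀, hK₁, hK₂⟩ := exists_norm_oscKernel_le ha0 ha1 hp0 hpq
  set m : ℝ := max C₀ 2 with hm
  have hm0 : 0 < m := lt_max_of_lt_left hC₀
  set r₀ : ℝ := p * B with hr₀
  have hr₀0 : 0 < r₀ := by positivity
  have hr : ∀ η ∈ Icc b B, r₀ ≤ sqrtBump p q η := by
    intro η hη
    rw [sqrtBump_eq ⟨by linarith [hη.1], by linarith [hη.2]⟩]
    have h1 : p ≤ η - p := by rw [hp]; linarith [hη.1]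
    have h2 : B ≤ q - η := by rw [hq]; linarith [hη.2]
    exact mul_le_mul h1 h2 hB.le (hp0.le.trans h1)
  refine ⟨C₁ * (4 * √(1 + m) + 4) * (r₀⁻¹) ^ 2, by positivity,
    fun M hM ρ N hMN G hG τ hτ hτN => ?_⟩
  set M' : ℝ := m * M with hM'
  have hM'0 : 0 ≤ M' := by positivity
  set A : ℝ := C₁ * (4 * √(1 + M') + 4) with hA
  have hA0 : 0 < A := by positivity
  have hAle : A ≤ C₁ * (4 * √(1 + m) + 4) * √M := by
    have h1 : √(1 + M') ≤ √(1 + m) * √M := by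
      rw [← Real.sqrt_mul (by positivity)]
      exact Real.sqrt_le_sqrt (by rw [hM']; nlinarith)
    have h2 : 1 ≤ √M := Real.one_le_sqrt.mpr hM
    calc A ≤ C₁ * (4 * (√(1 + m) * √M) + 4 * √M) := by rw [hA]; gcongr; linarith
      _ = _ := by ring
  -- the amplitude is split evenly between the operator and its adjoint
  set e : ℝ → ℝ → ℂ := fun x η =>
    cexp (I * ((x * η + τ x * η ^ a : ℝ) : ℂ)) * (sqrtBump p q η : ℂ) with he
  have hem : Measurable (uncurry e) := by
    simp only [he, sqrtBump, uncurry_def]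
    fun_prop
  have heb : ∀ x η, ‖e x η‖ ≤ (q - p) ^ 2 := by
    intro x η
    rw [he, norm_mul, norm_exp_I_mul_ofReal, one_mul, norm_real,
      Real.norm_of_nonneg (r := sqrtBump p q η) (le_max_left _ _)]
    exact sqrtBump_le p q η
  set F : ℝ → ℂ := (Icc b B).indicator fun η => ((sqrtBump p q η)⁻¹ : ℝ) * G η with hF
  have hsub : Icc b B ⊆ Icc p q := Icc_subset_Icc (by rw [hp]; linarith) (by rw [hq]; linarith)
  have hFle : ∀ η, ‖F η‖ₑ ≤ ENNReal.ofReal r₀⁻¹ * ‖(Icc b B).indicator G η‖ₑ := by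
    intro η
    by_cases hη : η ∈ Icc b B
    · rw [hF, indicator_of_mem hη, indicator_of_mem hη, enorm_mul]
      gcongr
      rw [← ofReal_norm, norm_real]
      refine ENNReal.ofReal_le_ofReal ?_
      have := hr η hη
      rw [Real.norm_of_nonneg (inv_nonneg.mpr (hr₀0.le.trans this))]
      exact inv_anti₀ hr₀0 this
    · simp [hF, indicator_of_notMem hη]
  have hGind : MemLp ((Icc b B).indicator G) 2 (volume.restrict (Icc p q)) :=
    ((memLp_indicator_iff_restrict measurableSet_Icc).mpr hG).restrict _
  have hFmem : MemLp F 2 (volume.restrict (Icc p q)) := by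
    refine MemLp.of_le_mul (c := r₀⁻¹) hGind ?_ (Filter.Eventually.of_forall fun η => ?_)
    · have h1 : AEStronglyMeasurable F volume := by
        refine (aestronglyMeasurable_indicator_iff measurableSet_Icc).mpr (.mul ?_ hG.1)
        refine Measurable.aestronglyMeasurable ?_
        simp only [sqrtBump]
        fun_prop
      exact h1.restrict
    · have h1 := hFle η
      rw [← ofReal_norm, ← ofReal_norm, ← ENNReal.ofReal_mul (by positivity)] at h1
      exact (ENNReal.ofReal_le_ofReal_iff (by positivity)).mp h1
  have hT : ∀ x, ∫ η in Icc p q, e x η * F η = oscOp a b B G x (τ x) := by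
    intro x
    have h1 : ∀ η, e x η * F η = (Icc b B).indicator
        (fun η => cexp (I * ((x * η + τ x * η ^ a : ℝ) : ℂ)) * G η) η := by
      intro η
      by_cases hη : η ∈ Icc b B
      · have h0 : (sqrtBump p q η : ℂ) ≠ 0 := by
          exact_mod_cast (hr₀0.trans_le (hr η hη)).ne'
        rw [hF, indicator_of_mem hη, indicator_of_mem hη, he]
        push_cast
        field_simp
      · simp [hF, indicator_of_notMem hη]
    simp_rw [h1]
    rw [setIntegral_indicator measurableSet_Icc, inter_eq_self_of_subset_right hsub]
    rfl
  have hTT : ∀ x y, ∫ η in Icc p q, e x η * conj (e y η) = oscKernel a p q (x - y) (τ x - τ y) := by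
    intro x y
    rw [oscKernel, intervalIntegral.integral_of_le hpq, ← integral_Icc_eq_integral_Ioc]
    refine setIntegral_congr_fun measurableSet_Icc fun η hη => ?_
    simp only [he, map_mul, ← exp_conj, conj_I, conj_ofReal]
    rw [sqrtBump_eq hη, quarticBump, mul_mul_mul_comm, ← Complex.exp_add]
    congr 1
    · congr 1
      push_cast
      ring
    · push_cast
      ring
  have hk : Measurable (uncurry fun x y => C₁ * kernelMajorant M' (x - y)) :=
    ((measurable_kernelMajorant M').comp (measurable_fst.sub measurable_snd)).const_mul C₁
  have hmaj : ∀ X t : ℝ, (|X| ≤ M' ∨ C₀ * |t| ≤ |X|) →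
      ‖oscKernel a p q X t‖ ≤ C₁ * kernelMajorant M' X := by
    intro X t h
    have hpos : 0 ≤ 1 / (1 + |X|) ^ 2 := by positivity
    by_cases hX : |X| ≤ M'
    · refine (hK₁ X t).trans ?_
      rw [kernelMajorant, indicator_of_mem (mem_Icc.mpr (abs_le.mp hX)),
        div_eq_mul_one_div]
      gcongr
      linarith
    · refine (hK₂ X t (h.resolve_left hX)).trans ?_
      rw [kernelMajorant, indicator_of_notMem (fun h => hX (abs_le.mpr (mem_Icc.mp h))),
        zero_add, div_eq_mul_one_div]
  obtain ⟨hkint, hkle⟩ := integrable_kernelMajorant hM'0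
  have : IsFiniteMeasure (volume.restrict (Metric.ball (0 : ℝ) ρ)) :=
    isFiniteMeasure_restrict.mpr measure_ball_lt_top.ne
  have key := lintegral_enorm_sq_le_of_kernel_bound
    (ν := volume.restrict (Metric.ball (0 : ℝ) ρ)) (μ := volume.restrict (Icc p q)) hem heb hk
    (M := C₁ * 2) (A := A) ?_ ?_ ?_ ?_ hA0 ?_ hFmem
  · simp_rw [hT] at key
    refine key.trans ?_
    have hFG : ∫⁻ η in Icc p q, ‖F η‖ₑ ^ 2
        ≤ ENNReal.ofReal (r₀⁻¹ ^ 2) * ∫⁻ η in Icc b B, ‖G η‖ₑ ^ 2 := by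
      calc ∫⁻ η in Icc p q, ‖F η‖ₑ ^ 2
          ≤ ∫⁻ η, ENNReal.ofReal (r₀⁻¹ ^ 2) * (Icc b B).indicator (fun η => ‖G η‖ₑ ^ 2) η := by
            refine (setLIntegral_le_lintegral _ _).trans (lintegral_mono fun η => ?_)
            refine (pow_le_pow_left' (hFle η) 2).trans_eq ?_
            rw [mul_pow, ← ENNReal.ofReal_pow (by positivity)]
            by_cases hη : η ∈ Icc b B
            · simp [indicator_of_mem hη]
            · simp [indicator_of_notMem hη]
        _ = _ := by
            rw [lintegral_const_mul' _ _ ENNReal.ofReal_ne_top,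
              lintegral_indicator measurableSet_Icc]
    calc ENNReal.ofReal A * ∫⁻ η in Icc p q, ‖F η‖ₑ ^ 2
        ≤ ENNReal.ofReal (C₁ * (4 * √(1 + m) + 4) * √M)
          * (ENNReal.ofReal (r₀⁻¹ ^ 2) * ∫⁻ η in Icc b B, ‖G η‖ₑ ^ 2) := by
          gcongr
      _ = _ := by
          rw [← mul_assoc, ← ENNReal.ofReal_mul (by positivity)]
          congr 2
          ring
  · intro x y
    rw [abs_of_nonneg (mul_nonneg hC₁.le (kernelMajorant_nonneg _ _))]
    exact mul_le_mul_of_nonneg_left (kernelMajorant_le_two _ _) hC₁.le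
  · exact fun x y => mul_nonneg hC₁.le (kernelMajorant_nonneg _ _)
  · intro x y
    rw [← kernelMajorant_neg, neg_sub]
  · filter_upwards [ae_restrict_mem measurableSet_ball] with x hx
    filter_upwards [ae_restrict_mem measurableSet_ball] with y hy
    rw [hTT]
    apply hmaj
    rcases hMN with h | h
    · by_cases hX : |x - y| ≤ M'
      · exact Or.inl hX
      right
      have h1 : |τ x - τ y| ≤ M := by
        obtain ⟨x1, x2⟩ := hτN x
        obtain ⟨y1, y2⟩ := hτN y
        rw [abs_le]
        constructor <;> linarith
      calc C₀ * |τ x - τ y| ≤ m * M := by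
            gcongr
            exact le_max_left _ _
        _ ≤ |x - y| := (not_le.mp hX).le
    · left
      rw [mem_ball_zero_iff, Real.norm_eq_abs] at hx hy
      calc |x - y| ≤ |x| + |y| := abs_sub x y
        _ ≤ 2 * M := by linarith
        _ ≤ M' := by
          rw [hM']
          gcongr
          exact le_max_right _ _
  · refine Filter.Eventually.of_forall fun x => ?_
    have hi : Integrable fun y => kernelMajorant M' (x - y) := hkint.comp_sub_left x
    calc ∫ y in Metric.ball (0 : ℝ) ρ, C₁ * kernelMajorant M' (x - y)
        ≤ ∫ y, C₁ * kernelMajorant M' (x - y) :=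
          setIntegral_le_integral (hi.const_mul C₁) (Filter.Eventually.of_forall fun y =>
            mul_nonneg hC₁.le (kernelMajorant_nonneg _ _))
      _ = C₁ * ∫ y, kernelMajorant M' y := by
          rw [integral_const_mul, integral_sub_left_eq_self]
      _ ≤ A := mul_le_mul_of_nonneg_left hkle hC₁.le

/-- The maximal function `sup_{0 ≤ τ ≤ N} |∫_b^B e^{i(xη + τη^a)} G(η) dη|`. -/
noncomputable def oscMax (a b B : ℝ) (G : ℝ → ℂ) (N x : ℝ) : ℝ≥0∞ :=
  ⨆ τ ∈ Icc 0 N, ‖oscOp a b B G x τ‖ₑ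

theorem measurable_oscMax {a b B : ℝ} {G : ℝ → ℂ}
    (hG : Integrable G (volume.restrict (Icc b B))) (N : ℝ) : Measurable (oscMax a b B G N) := by
  have hc := continuous_oscOp (a := a) hG
  refine LowerSemicontinuous.measurable (lowerSemicontinuous_biSup fun τ _ => ?_)
  exact ((hc.comp (Continuous.prodMk continuous_id continuous_const)).enorm).lowerSemicontinuous

theorem eLpNorm_two_sq {X ε : Type*} [MeasurableSpace X] [ENorm ε] (μ : Measure X) (f : X → ε) :
    eLpNorm f 2 μ ^ 2 = ∫⁻ x, ‖f x‖ₑ ^ 2 ∂μ := by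
  have := eLpNorm_nnreal_pow_eq_lintegral (f := f) (μ := μ) (p := 2) (by norm_num)
  simpa using this

/-- The maximal estimate at unit frequency. The times may be restricted to `[0, M]`, or the space
variable to a ball of radius `M`. -/
theorem exists_eLpNorm_oscMax_le {a b B : ℝ} (ha0 : 0 < a) (ha1 : a ≠ 1) (hb : 0 < b)
    (hbB : b ≤ B) :
    ∃ C : ℝ, 0 < C ∧ ∀ M : ℝ, 1 ≤ M → ∀ ρ N : ℝ, 0 ≤ N → (N ≤ M ∨ ρ ≤ M) →
      ∀ G : ℝ → ℂ, MemLp G 2 (volume.restrict (Icc b B)) →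
        eLpNorm (oscMax a b B G N) 2 (volume.restrict (Metric.ball (0 : ℝ) ρ))
          ≤ ENNReal.ofReal (C * M ^ (1 / 4 : ℝ)) * eLpNorm G 2 (volume.restrict (Icc b B)) := by
  obtain ⟨C, hC, h⟩ := exists_oscOp_linearised_bound ha0 ha1 hb hbB
  refine ⟨√C, Real.sqrt_pos.mpr hC, fun M hM ρ N hN hMN G hG => ?_⟩
  have hGi : Integrable G (volume.restrict (Icc b B)) := hG.integrable (by norm_num)
  have key := lintegral_biSup_sq_le_of_linearised (continuous_oscOp (a := a) hGi)
    ⟨0, left_mem_Icc.mpr hN⟩ (h M hM ρ N hMN G hG)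
  rw [← ENNReal.pow_le_pow_left_iff two_ne_zero, mul_pow, eLpNorm_two_sq, eLpNorm_two_sq,
    ← ENNReal.ofReal_pow (by positivity)]
  have e : (√C * M ^ (1 / 4 : ℝ)) ^ 2 = C * √M := by
    have hM0 : 0 ≤ M := by linarith
    rw [mul_pow, Real.sq_sqrt hC.le, ← Real.rpow_natCast (M ^ (1 / 4 : ℝ)), ← Real.rpow_mul hM0,
      Real.sqrt_eq_rpow]
    norm_num
  rw [e]
  simpa [oscMax] using key

end Maximal

/-! ### Dyadic decomposition in time -/

section Dyadic

open Complex Set Function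

/-- The maximal difference quotient `sup_{0 < τ < N} τ^{-δ} |u(x, τ) - u(x, 0)|` for
`u(x, τ) = ∫_b^B e^{i(xη + τη^a)} G(η) dη`. -/
noncomputable def oscRate (a δ b B : ℝ) (G : ℝ → ℂ) (N x : ℝ) : ℝ≥0∞ :=
  ⨆ τ ∈ Ioo 0 N, ‖oscOp a b B G x τ - oscOp a b B G x 0‖ₑ * ENNReal.ofReal (τ ^ (-δ))

theorem memLp_rpow_mul {a b B : ℝ} (hb : 0 < b) (ha : 0 < a) {G : ℝ → ℂ}
    (hG : MemLp G 2 (volume.restrict (Icc b B))) :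
    MemLp (fun η => I * ((η ^ a : ℝ) : ℂ) * G η) 2 (volume.restrict (Icc b B)) ∧
      eLpNorm (fun η => I * ((η ^ a : ℝ) : ℂ) * G η) 2 (volume.restrict (Icc b B))
        ≤ ENNReal.ofReal (B ^ a) * eLpNorm G 2 (volume.restrict (Icc b B)) := by
  have hle : ∀ᵐ η ∂volume.restrict (Icc b B), ‖I * ((η ^ a : ℝ) : ℂ) * G η‖ ≤ B ^ a * ‖G η‖ := by
    filter_upwards [ae_restrict_mem measurableSet_Icc] with η hη
    have h0 : 0 ≤ η := hb.le.trans hη.1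
    rw [norm_mul, norm_mul, norm_I, one_mul, norm_real,
      Real.norm_of_nonneg (Real.rpow_nonneg h0 a)]
    gcongr
    exact hη.2
  refine ⟨hG.of_le_mul (.mul ?_ hG.1) hle, eLpNorm_le_mul_eLpNorm_of_ae_le_mul hle 2⟩
  exact Measurable.aestronglyMeasurable (by fun_prop)

theorem hasDerivAt_oscOp {a b B : ℝ} (hb : 0 < b) (ha : 0 < a) {G : ℝ → ℂ}
    (hG : MemLp G 2 (volume.restrict (Icc b B))) (x τ : ℝ) :
    HasDerivAt (oscOp a b B G x) (oscOp a b B (fun η => I * ((η ^ a : ℝ) : ℂ) * G η) x τ) τ := by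
  have hGi : Integrable G (volume.restrict (Icc b B)) := hG.integrable (by norm_num)
  have hG'i := (memLp_rpow_mul hb ha hG).1.integrable (by norm_num)
  have hmeas : ∀ σ : ℝ, Measurable fun η : ℝ => cexp (I * ((x * η + σ * η ^ a : ℝ) : ℂ)) :=
    fun σ => by fun_prop
  refine (hasDerivAt_integral_of_dominated_loc_of_deriv_le
    (F := fun σ η => cexp (I * ((x * η + σ * η ^ a : ℝ) : ℂ)) * G η)
    (F' := fun σ η => cexp (I * ((x * η + σ * η ^ a : ℝ) : ℂ)) * (I * ((η ^ a : ℝ) : ℂ) * G η))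
    (bound := fun η => ‖I * ((η ^ a : ℝ) : ℂ) * G η‖) (Filter.univ_mem)
    (Filter.Eventually.of_forall fun σ => ?_) ?_ ?_ ?_ hG'i.norm ?_).2
  · exact (hmeas σ).aestronglyMeasurable.mul hGi.1
  · refine hGi.bdd_mul (c := 1) (hmeas τ).aestronglyMeasurable
      (Filter.Eventually.of_forall fun η => ?_)
    rw [norm_exp_I_mul_ofReal]
  · exact (hmeas τ).aestronglyMeasurable.mul hG'i.1
  · refine Filter.Eventually.of_forall fun η σ _ => ?_
    rw [norm_mul, norm_exp_I_mul_ofReal, one_mul]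
  · refine Filter.Eventually.of_forall fun η σ _ => ?_
    have h1 : HasDerivAt (fun σ : ℝ => x * η + σ * η ^ a) (η ^ a) σ := by
      simpa using ((hasDerivAt_id σ).mul_const (η ^ a)).const_add (x * η)
    refine (((h1.ofReal_comp.const_mul I).cexp).mul_const (G η)).congr_deriv ?_
    ring

/-- For short times the difference quotient is controlled by the time derivative. -/
theorem enorm_oscOp_sub_mul_le_of_le_one {a δ b B : ℝ} (hb : 0 < b) (ha : 0 < a) (hδ1 : δ < 1)
    {G : ℝ → ℂ} (hG : MemLp G 2 (volume.restrict (Icc b B))) (x : ℝ) {τ : ℝ} (hτ : 0 < τ)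
    (hτ1 : τ ≤ 1) :
    ‖oscOp a b B G x τ - oscOp a b B G x 0‖ₑ * ENNReal.ofReal (τ ^ (-δ))
      ≤ oscMax a b B (fun η => I * ((η ^ a : ℝ) : ℂ) * G η) 1 x := by
  set S := oscMax a b B (fun η => I * ((η ^ a : ℝ) : ℂ) * G η) 1 x with hS
  rcases eq_or_ne S ⊤ with h | h
  · rw [h]; exact le_top
  have hbd : ∀ σ ∈ Icc 0 τ, ‖oscOp a b B (fun η => I * ((η ^ a : ℝ) : ℂ) * G η) x σ‖
      ≤ S.toReal := by
    intro σ hσ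
    rw [← toReal_enorm]
    refine ENNReal.toReal_mono h ?_
    exact le_iSup₂ (f := fun σ (_ : σ ∈ Icc (0 : ℝ) 1) =>
      ‖oscOp a b B (fun η => I * ((η ^ a : ℝ) : ℂ) * G η) x σ‖ₑ) σ ⟨hσ.1, hσ.2.trans hτ1⟩
  have hmv := (convex_Icc 0 τ).norm_image_sub_le_of_norm_hasDerivWithin_le
    (fun σ _ => (hasDerivAt_oscOp hb ha hG x σ).hasDerivWithinAt) hbd
    (left_mem_Icc.mpr hτ.le) (right_mem_Icc.mpr hτ.le)
  rw [sub_zero, Real.norm_of_nonneg hτ.le] at hmv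
  rw [← ENNReal.ofReal_toReal h, ← ofReal_norm, ← ENNReal.ofReal_mul (norm_nonneg _)]
  refine ENNReal.ofReal_le_ofReal ?_
  calc ‖oscOp a b B G x τ - oscOp a b B G x 0‖ * τ ^ (-δ)
      ≤ S.toReal * τ * τ ^ (-δ) := by gcongr
    _ = S.toReal * τ ^ (1 - δ) := by
        rw [mul_assoc, sub_eq_add_neg, Real.rpow_add hτ, Real.rpow_one]
    _ ≤ S.toReal * 1 := by
        gcongr
        exact Real.rpow_le_one hτ.le hτ1 (by linarith)
    _ = S.toReal := mul_one _

theorem enorm_oscOp_sub_le {a b B : ℝ} {G : ℝ → ℂ} (x : ℝ) {τ N : ℝ} (hτ : 0 ≤ τ) (hτN : τ ≤ N) :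
    ‖oscOp a b B G x τ - oscOp a b B G x 0‖ₑ ≤ 2 * oscMax a b B G N x := by
  have h : ∀ σ ∈ Icc 0 N, ‖oscOp a b B G x σ‖ₑ ≤ oscMax a b B G N x := fun σ hσ =>
    le_iSup₂ (f := fun σ (_ : σ ∈ Icc (0 : ℝ) N) => ‖oscOp a b B G x σ‖ₑ) σ hσ
  refine enorm_sub_le.trans ?_
  rw [two_mul]
  exact add_le_add (h τ ⟨hτ, hτN⟩) (h 0 ⟨le_rfl, hτ.trans hτN⟩)

/-- Dyadic decomposition of the times `0 < τ < N`: the short times `τ ≤ 1`, the dyadic intervals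
`[2^j, 2^{j+1}]` with `j < J`, and the remaining times. -/
theorem oscRate_le {a δ b B : ℝ} (hb : 0 < b) (ha : 0 < a) (hδ0 : 0 ≤ δ) (hδ1 : δ < 1)
    {G : ℝ → ℂ} (hG : MemLp G 2 (volume.restrict (Icc b B))) (J : ℕ) (N x : ℝ) :
    oscRate a δ b B G N x ≤ oscMax a b B (fun η => I * ((η ^ a : ℝ) : ℂ) * G η) 1 x
      + ∑ j ∈ Finset.range J,
        ENNReal.ofReal (2 * ((2 : ℝ) ^ j) ^ (-δ)) * oscMax a b B G (2 ^ (j + 1)) x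
      + ENNReal.ofReal (2 * ((2 : ℝ) ^ J) ^ (-δ)) * oscMax a b B G N x := by
  refine iSup₂_le fun τ hτ => ?_
  rcases le_total τ 1 with h1 | h1
  · exact (enorm_oscOp_sub_mul_le_of_le_one hb ha hδ1 hG x hτ.1 h1).trans
      (le_self_add.trans le_self_add)
  have bound : ∀ i : ℕ, ∀ N' : ℝ, (2 : ℝ) ^ i ≤ τ → τ ≤ N' →
      ‖oscOp a b B G x τ - oscOp a b B G x 0‖ₑ * ENNReal.ofReal (τ ^ (-δ))
        ≤ ENNReal.ofReal (2 * ((2 : ℝ) ^ i) ^ (-δ)) * oscMax a b B G N' x := by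
    intro i N' hi hN'
    rw [ENNReal.ofReal_mul zero_le_two, ENNReal.ofReal_ofNat]
    calc ‖oscOp a b B G x τ - oscOp a b B G x 0‖ₑ * ENNReal.ofReal (τ ^ (-δ))
        ≤ 2 * oscMax a b B G N' x * ENNReal.ofReal (((2 : ℝ) ^ i) ^ (-δ)) := by
          refine mul_le_mul' (enorm_oscOp_sub_le x hτ.1.le hN') (ENNReal.ofReal_le_ofReal ?_)
          exact Real.rpow_le_rpow_of_nonpos (by positivity) hi (neg_nonpos.mpr hδ0)
      _ = _ := by ring
  obtain ⟨j, hj1, hj2⟩ := exists_nat_pow_near h1 (one_lt_two (α := ℝ))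
  rcases lt_or_ge j J with hj | hj
  · refine (bound j _ hj1 hj2.le).trans (le_trans ?_ (le_self_add (b := _)))
    refine le_trans ?_ (le_add_self)
    exact Finset.single_le_sum (f := fun j => ENNReal.ofReal (2 * ((2 : ℝ) ^ j) ^ (-δ))
      * oscMax a b B G (2 ^ (j + 1)) x) (fun _ _ => zero_le) (Finset.mem_range.mpr hj)
  · refine (bound J N ?_ hτ.2.le).trans le_add_self
    exact (pow_le_pow_right₀ one_le_two hj).trans hj1

theorem eLpNorm_two_const_mul {X : Type*} [MeasurableSpace X] (μ : Measure X) {c : ℝ≥0∞}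
    (hc : c ≠ ⊤) (f : X → ℝ≥0∞) :
    eLpNorm (fun x => c * f x) 2 μ = c * eLpNorm f 2 μ := by
  have h : eLpNorm (fun x => c * f x) 2 μ ^ 2 = (c * eLpNorm f 2 μ) ^ 2 := by
    simp only [eLpNorm_two_sq, mul_pow, enorm_eq_self]
    exact lintegral_const_mul' _ _ (ENNReal.pow_ne_top hc)
  exact le_antisymm ((ENNReal.pow_le_pow_left_iff two_ne_zero).mp h.le)
    ((ENNReal.pow_le_pow_left_iff two_ne_zero).mp h.ge)

/-- The maximal difference quotient at unit frequency, for times below `2^J`, or for all times in a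
ball of radius `2^J`. -/
theorem exists_eLpNorm_oscRate_le {a δ b B : ℝ} (ha0 : 0 < a) (ha1 : a ≠ 1) (hb : 0 < b)
    (hbB : b ≤ B) (hδ0 : 0 ≤ δ) (hδ1 : δ < 1) :
    ∃ C : ℝ, 0 < C ∧ ∀ J : ℕ, ∀ ρ N : ℝ, 0 ≤ N → (N ≤ 2 ^ J ∨ ρ ≤ 2 ^ J) →
      ∀ G : ℝ → ℂ, MemLp G 2 (volume.restrict (Icc b B)) →
        eLpNorm (oscRate a δ b B G N) 2 (volume.restrict (Metric.ball (0 : ℝ) ρ))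
          ≤ ENNReal.ofReal (C * ∑ j ∈ Finset.range (J + 1), ((2 : ℝ) ^ (1 / 4 - δ)) ^ j)
            * eLpNorm G 2 (volume.restrict (Icc b B)) := by
  obtain ⟨C, hC, h⟩ := exists_eLpNorm_oscMax_le ha0 ha1 hb hbB
  have hB : 0 < B := hb.trans_le hbB
  refine ⟨C * B ^ a + 4 * C, by positivity, fun J ρ N hN hJ G hG => ?_⟩
  set ν := volume.restrict (Metric.ball (0 : ℝ) ρ)
  set Q := eLpNorm G 2 (volume.restrict (Icc b B)) with hQ
  set r : ℝ := (2 : ℝ) ^ (1 / 4 - δ) with hr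
  have hr0 : 0 < r := by positivity
  obtain ⟨hG', hG'le⟩ := memLp_rpow_mul hb ha0 hG
  have hGi : Integrable G (volume.restrict (Icc b B)) := hG.integrable (by norm_num)
  have hG'i := hG'.integrable (by norm_num)
  have hrj : ∀ j : ℕ, ((2 : ℝ) ^ j) ^ (-δ) * ((2 : ℝ) ^ j) ^ (1 / 4 : ℝ) = r ^ j := by
    intro j
    rw [← Real.rpow_add (by positivity), hr, ← Real.rpow_natCast, ← Real.rpow_natCast,
      ← Real.rpow_mul zero_le_two, ← Real.rpow_mul zero_le_two]
    ring_nf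
  have b0 : eLpNorm (oscMax a b B (fun η => I * ((η ^ a : ℝ) : ℂ) * G η) 1) 2 ν
      ≤ ENNReal.ofReal (C * B ^ a) * Q := by
    refine (h 1 le_rfl ρ 1 zero_le_one (Or.inl le_rfl) _ hG').trans ?_
    rw [Real.one_rpow, mul_one, ENNReal.ofReal_mul hC.le, mul_assoc]
    gcongr
  have bj : ∀ j : ℕ, eLpNorm (fun x => ENNReal.ofReal (2 * ((2 : ℝ) ^ j) ^ (-δ))
      * oscMax a b B G (2 ^ (j + 1)) x) 2 ν ≤ ENNReal.ofReal (4 * C * r ^ j) * Q := by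
    intro j
    rw [eLpNorm_two_const_mul ν ENNReal.ofReal_ne_top]
    refine (mul_le_mul_right (h (2 ^ (j + 1)) (one_le_pow₀ one_le_two) ρ (2 ^ (j + 1))
      (by positivity) (Or.inl le_rfl) G hG) _).trans ?_
    rw [← mul_assoc, ← ENNReal.ofReal_mul (by positivity)]
    refine mul_le_mul' (ENNReal.ofReal_le_ofReal ?_) le_rfl
    have h2 : (2 : ℝ) ^ (1 / 4 : ℝ) ≤ 2 := by
      calc (2 : ℝ) ^ (1 / 4 : ℝ) ≤ 2 ^ (1 : ℝ) :=
            Real.rpow_le_rpow_of_exponent_le one_le_two (by norm_num)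
        _ = 2 := Real.rpow_one 2
    rw [pow_succ, Real.mul_rpow (by positivity) zero_le_two, ← hrj]
    calc 2 * ((2 : ℝ) ^ j) ^ (-δ) * (C * (((2 : ℝ) ^ j) ^ (1 / 4 : ℝ) * 2 ^ (1 / 4 : ℝ)))
        ≤ 2 * ((2 : ℝ) ^ j) ^ (-δ) * (C * (((2 : ℝ) ^ j) ^ (1 / 4 : ℝ) * 2)) := by gcongr
      _ = _ := by ring
  have bJ : eLpNorm (fun x => ENNReal.ofReal (2 * ((2 : ℝ) ^ J) ^ (-δ)) * oscMax a b B G N x) 2 ν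
      ≤ ENNReal.ofReal (4 * C * r ^ J) * Q := by
    rw [eLpNorm_two_const_mul ν ENNReal.ofReal_ne_top]
    refine (mul_le_mul_right (h (2 ^ J) (one_le_pow₀ one_le_two) ρ N hN hJ G hG) _).trans ?_
    rw [← mul_assoc, ← ENNReal.ofReal_mul (by positivity)]
    refine mul_le_mul' (ENNReal.ofReal_le_ofReal ?_) le_rfl
    rw [← hrj]
    have : 0 ≤ C * (((2 : ℝ) ^ J) ^ (-δ) * ((2 : ℝ) ^ J) ^ (1 / 4 : ℝ)) := by positivity
    linarith
  have meas : ∀ c : ℝ≥0∞, ∀ N, AEStronglyMeasurable (fun x => c * oscMax a b B G N x) ν :=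
    fun c N => ((measurable_oscMax hGi N).const_mul c).aestronglyMeasurable
  calc eLpNorm (oscRate a δ b B G N) 2 ν
      ≤ eLpNorm (oscMax a b B (fun η => I * ((η ^ a : ℝ) : ℂ) * G η) 1
          + ∑ j ∈ Finset.range J, (fun x => ENNReal.ofReal (2 * ((2 : ℝ) ^ j) ^ (-δ))
            * oscMax a b B G (2 ^ (j + 1)) x)
          + fun x => ENNReal.ofReal (2 * ((2 : ℝ) ^ J) ^ (-δ)) * oscMax a b B G N x) 2 ν := by
        refine eLpNorm_mono_enorm fun x => ?_
        simp only [enorm_eq_self, Pi.add_apply, Finset.sum_apply]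
        exact oscRate_le hb ha0 hδ0 hδ1 hG J N x
    _ ≤ ENNReal.ofReal (C * B ^ a) * Q
          + ∑ j ∈ Finset.range J, ENNReal.ofReal (4 * C * r ^ j) * Q
          + ENNReal.ofReal (4 * C * r ^ J) * Q := by
        have m0 := (measurable_oscMax (a := a) hG'i 1).aestronglyMeasurable (μ := ν)
        have ms : AEStronglyMeasurable (∑ j ∈ Finset.range J,
            (fun x => ENNReal.ofReal (2 * ((2 : ℝ) ^ j) ^ (-δ))
              * oscMax a b B G (2 ^ (j + 1)) x)) ν :=
          Finset.aestronglyMeasurable_sum _ fun j _ => meas _ _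
        refine (eLpNorm_add_le (m0.add ms) (meas _ _) one_le_two).trans (add_le_add ?_ bJ)
        refine (eLpNorm_add_le m0 ms one_le_two).trans (add_le_add b0 ?_)
        exact (eLpNorm_sum_le (fun j _ => meas _ _) one_le_two).trans
          (Finset.sum_le_sum fun j _ => bj j)
    _ = ENNReal.ofReal (C * B ^ a + 4 * C * ∑ j ∈ Finset.range (J + 1), r ^ j) * Q := by
        rw [← Finset.sum_mul, ← add_mul, ← add_mul, ← ENNReal.ofReal_sum_of_nonneg
          (fun j _ => by positivity), ← ENNReal.ofReal_add (by positivity) (by positivity),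
          ← ENNReal.ofReal_add (by positivity) (by positivity), Finset.sum_range_succ,
          ← Finset.mul_sum]
        congr 2
        ring
    _ ≤ _ := by
        gcongr
        have h1 : 1 ≤ ∑ j ∈ Finset.range (J + 1), r ^ j := by
          have := Finset.single_le_sum (f := fun j => r ^ j) (fun j _ => by positivity)
            (Finset.mem_range.mpr (Nat.succ_pos J))
          simpa using this
        have : 0 ≤ C * B ^ a := by positivity
        nlinarith

theorem sum_pow_le_mul_rpow (δ : ℝ) (J : ℕ) :
    ∑ j ∈ Finset.range (J + 1), ((2 : ℝ) ^ (1 / 4 - δ)) ^ j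
      ≤ (J + 1) * ((2 : ℝ) ^ (max δ (1 / 4) - δ)) ^ J := by
  have h1 : (1 : ℝ) ≤ 2 ^ (max δ (1 / 4) - δ) :=
    Real.one_le_rpow one_le_two (sub_nonneg.mpr (le_max_left _ _))
  calc ∑ j ∈ Finset.range (J + 1), ((2 : ℝ) ^ (1 / 4 - δ)) ^ j
      ≤ ∑ _j ∈ Finset.range (J + 1), ((2 : ℝ) ^ (max δ (1 / 4) - δ)) ^ J := by
        refine Finset.sum_le_sum fun j hj => ?_
        calc ((2 : ℝ) ^ (1 / 4 - δ)) ^ j ≤ ((2 : ℝ) ^ (max δ (1 / 4) - δ)) ^ j := by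
              gcongr
              · exact one_le_two
              · exact le_max_right _ _
          _ ≤ _ := pow_le_pow_right₀ h1 (Nat.lt_succ_iff.mp (Finset.mem_range.mp hj))
    _ = _ := by simp

theorem exists_sum_pow_le_rpow {δ : ℝ} (hδ4 : δ ≠ 1 / 4) :
    ∃ C : ℝ, 0 < C ∧ ∀ J : ℕ, ∑ j ∈ Finset.range (J + 1), ((2 : ℝ) ^ (1 / 4 - δ)) ^ j
      ≤ C * ((2 : ℝ) ^ (max δ (1 / 4) - δ)) ^ J := by
  set r : ℝ := (2 : ℝ) ^ (1 / 4 - δ) with hr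
  have hr0 : 0 < r := by positivity
  rcases lt_or_gt_of_ne hδ4 with h | h
  · have h1 : 1 < r := Real.one_lt_rpow one_lt_two (by linarith)
    refine ⟨r / (r - 1), div_pos hr0 (sub_pos.mpr h1), fun J => ?_⟩
    rw [max_eq_right h.le, geom_sum_eq h1.ne', ← hr, div_mul_eq_mul_div]
    gcongr
    rw [pow_succ']
    linarith
  · have h1 : r < 1 := Real.rpow_lt_one_of_one_lt_of_neg one_lt_two (by linarith)
    refine ⟨(1 - r)⁻¹, inv_pos.mpr (sub_pos.mpr h1), fun J => ?_⟩
    rw [max_eq_left h.le, sub_self, Real.rpow_zero, one_pow, mul_one]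
    rw [← tsum_geometric_of_lt_one hr0.le h1]
    exact (summable_geometric_of_lt_one hr0.le h1).sum_le_tsum _ fun j _ => by positivity

end Dyadic

/-! ### Fourier inversion on `L²` and rescaling to unit frequency -/

section Transfer

open Complex Set Function SchwartzMap

/-- Fourier inversion for an `L²` function with integrable Fourier transform. -/
theorem ae_eq_fourierInv_of_integrable (f : Lp ℂ 2 (volume : Measure ℝ))
    (hu : Integrable (𝓕 f : Lp ℂ 2 (volume : Measure ℝ))) :
    ∀ᵐ x : ℝ, f x = 𝓕⁻ ((𝓕 f : Lp ℂ 2 (volume : Measure ℝ)) : ℝ → ℂ) x := by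
  set u : Lp ℂ 2 (volume : Measure ℝ) := 𝓕 f with hu'
  have hker : Measurable fun p : ℝ × ℝ => cexp (↑(2 * Real.pi * inner ℝ p.1 p.2) * I) := by
    fun_prop
  have hcont : Continuous (𝓕⁻ (u : ℝ → ℂ)) := by
    have : 𝓕⁻ (u : ℝ → ℂ) = fun w => ∫ v : ℝ, cexp (↑(2 * Real.pi * inner ℝ v w) * I) • u v := by
      funext w
      exact Real.fourierInv_eq' _ _
    rw [this]
    refine continuous_of_dominated (bound := fun v => ‖u v‖) (fun w => ?_) (fun w => ?_) hu.norm ?_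
    · have : Continuous fun v : ℝ => cexp (↑(2 * Real.pi * inner ℝ v w) * I) := by fun_prop
      exact AEStronglyMeasurable.smul this.aestronglyMeasurable hu.1
    · exact Filter.Eventually.of_forall fun v => by
        rw [norm_smul, norm_exp_ofReal_mul_I, one_mul]
    · exact Filter.Eventually.of_forall fun v => by fun_prop
  refine ae_eq_of_integral_contDiff_smul_eq ((Lp.memLp f).locallyIntegrable one_le_two)
    hcont.locallyIntegrable fun g hg hgs => ?_
  have hgs' : HasCompactSupport fun x => (g x : ℂ) := hgs.comp_left (g := fun y : ℝ => (y : ℂ)) rfl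
  have hg' : ContDiff ℝ (↑(⊤ : ℕ∞)) fun x => (g x : ℂ) := ofRealCLM.contDiff.comp hg
  set φ : 𝓢(ℝ, ℂ) := hgs'.toSchwartzMap hg' with hφ
  have hφg : ∀ x, φ x = g x := fun x => rfl
  have h1 : ∫ x, φ x • f x = ∫ w, (𝓕⁻ φ) w • u w := by
    have hf : f = 𝓕⁻ u := (FourierTransform.fourierInv_fourier_eq f).symm
    rw [← Lp.toTemperedDistribution_apply f φ, ← Lp.toTemperedDistribution_apply u (𝓕⁻ φ),
      ← TemperedDistribution.fourierInv_apply, Lp.fourierInv_toTemperedDistribution_eq, ← hf]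
  have hint : Integrable (fun p : ℝ × ℝ => cexp (↑(2 * Real.pi * inner ℝ p.1 p.2) * I)
      * (φ p.1 * u p.2)) (volume.prod volume) := by
    refine (φ.integrable.mul_prod hu).bdd_mul (c := 1) hker.aestronglyMeasurable
      (Filter.Eventually.of_forall fun p => ?_)
    rw [norm_exp_ofReal_mul_I]
  have h2 : ∀ w, (𝓕⁻ φ) w • u w
      = ∫ v, cexp (↑(2 * Real.pi * inner ℝ v w) * I) * (φ v * u w) := by
    intro w
    rw [fourierInv_coe, Real.fourierInv_eq', smul_eq_mul, ← integral_mul_const]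
    simp only [smul_eq_mul, mul_assoc]
  have h3 : ∀ v, g v • 𝓕⁻ (u : ℝ → ℂ) v
      = ∫ w, cexp (↑(2 * Real.pi * inner ℝ v w) * I) * (φ v * u w) := by
    intro v
    rw [Real.fourierInv_eq', real_smul, ← integral_const_mul]
    refine integral_congr_ae (Filter.Eventually.of_forall fun w => ?_)
    simp only [smul_eq_mul, hφg, real_inner_comm v w]
    ring
  calc ∫ x, g x • f x = ∫ x, φ x • f x := by
        simp only [hφg, real_smul, smul_eq_mul]
    _ = ∫ x, g x • 𝓕⁻ (u : ℝ → ℂ) x := by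
        rw [h1]
        simp_rw [h2, h3]
        exact (integral_integral_swap hint).symm

theorem measurableEmbedding_mul_left₀ {c : ℝ} (hc : c ≠ 0) :
    MeasurableEmbedding fun x : ℝ => c * x :=
  (Homeomorph.mulLeft₀ c hc).measurableEmbedding

theorem ae_comp_mul_left {c : ℝ} (hc : c ≠ 0) {P : ℝ → Prop} (h : ∀ᵐ x, P x) :
    ∀ᵐ x, P (c * x) := by
  have : Measure.QuasiMeasurePreserving (fun x : ℝ => c * x) volume volume := by
    refine ⟨by fun_prop, ?_⟩
    rw [Real.map_volume_mul_left hc]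
    exact Measure.smul_absolutelyContinuous
  exact this.ae h

theorem eLpNorm_two_comp_mul_left {ε : Type*} [ENorm ε] {c : ℝ} (hc : c ≠ 0) (g : ℝ → ε)
    (s : Set ℝ) :
    eLpNorm (fun x => g (c * x)) 2 (volume.restrict ((fun x => c * x) ⁻¹' s))
      = ENNReal.ofReal (√|c⁻¹|) * eLpNorm g 2 (volume.restrict s) := by
  have hm := measurableEmbedding_mul_left₀ hc
  have h : eLpNorm (fun x => g (c * x)) 2 (volume.restrict ((fun x => c * x) ⁻¹' s)) ^ 2
      = (ENNReal.ofReal (√|c⁻¹|) * eLpNorm g 2 (volume.restrict s)) ^ 2 := by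
    rw [mul_pow, eLpNorm_two_sq, eLpNorm_two_sq, ← ENNReal.ofReal_pow (Real.sqrt_nonneg _),
      Real.sq_sqrt (abs_nonneg _), ← smul_eq_mul, ← lintegral_smul_measure,
      ← Measure.restrict_smul, ← Real.map_volume_mul_left hc, hm.restrict_map, hm.lintegral_map]
  exact le_antisymm ((ENNReal.pow_le_pow_left_iff two_ne_zero).mp h.le)
    ((ENNReal.pow_le_pow_left_iff two_ne_zero).mp h.ge)

theorem measurable_angularFourier (f : Lp ℂ 2 (volume : Measure ℝ)) :
    Measurable (angularFourier f) :=
  (Lp.stronglyMeasurable (𝓕 f : Lp ℂ 2 (volume : Measure ℝ))).measurable.comp (by fun_prop)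

/-- Plancherel's theorem in the angular-frequency normalisation. -/
theorem eLpNorm_angularFourier (f : Lp ℂ 2 (volume : Measure ℝ)) :
    eLpNorm (angularFourier f) 2 volume
      = ENNReal.ofReal (√(2 * Real.pi)) * eLpNorm f 2 volume := by
  have hc : (2 * Real.pi)⁻¹ ≠ 0 := by positivity
  have h := eLpNorm_two_comp_mul_left hc
    ((𝓕 f : Lp ℂ 2 (volume : Measure ℝ)) : ℝ → ℂ) univ
  rw [preimage_univ, Measure.restrict_univ, inv_inv, abs_of_pos Real.two_pi_pos] at h
  have e : angularFourier f
      = fun x => ((𝓕 f : Lp ℂ 2 (volume : Measure ℝ)) : ℝ → ℂ) ((2 * Real.pi)⁻¹ * x) := by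
    funext x
    rw [angularFourier, div_eq_inv_mul]
  rw [e, h, ← Lp.enorm_def, ← Lp.enorm_def, ← ofReal_norm, ← ofReal_norm, Lp.norm_fourier_eq]

theorem memLp_angularFourier (f : Lp ℂ 2 (volume : Measure ℝ)) :
    MemLp (angularFourier f) 2 volume := by
  refine ⟨(measurable_angularFourier f).aestronglyMeasurable, ?_⟩
  rw [eLpNorm_angularFourier]
  exact ENNReal.mul_lt_top ENNReal.ofReal_lt_top (Lp.eLpNorm_lt_top f)

theorem integrable_angularFourier {f : Lp ℂ 2 (volume : Measure ℝ)} {Λ R : ℝ}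
    (hf : FourierSupportedIn f (annulus Λ R)) : Integrable (angularFourier f) := by
  have h1 : IntegrableOn (angularFourier f) (Icc (-(Λ * R)) (Λ * R)) := by
    have : IsFiniteMeasure (volume.restrict (Icc (-(Λ * R)) (Λ * R))) :=
      isFiniteMeasure_restrict.mpr measure_Icc_lt_top.ne
    exact ((memLp_angularFourier f).restrict _).integrable (by norm_num)
  refine h1.integrable_of_ae_notMem_eq_zero ?_
  filter_upwards [hf] with ξ hξ hnot
  exact hξ fun h => hnot (abs_le.mp h.2)

/-- At time zero the solution is the initial datum. -/
theorem ae_eq_schrodingerOp_zero (a : ℝ) {f : Lp ℂ 2 (volume : Measure ℝ)}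
    (hf : Integrable (angularFourier f)) : ∀ᵐ x : ℝ, f x = schrodingerOp a f x 0 := by
  have hpi : 2 * Real.pi ≠ 0 := by positivity
  have hu : Integrable (𝓕 f : Lp ℂ 2 (volume : Measure ℝ)) := by
    refine (hf.comp_mul_left' hpi).congr (Filter.Eventually.of_forall fun x => ?_)
    simp only [angularFourier, mul_div_cancel_left₀ _ hpi]
  filter_upwards [ae_eq_fourierInv_of_integrable f hu] with x hx
  have h := Measure.integral_comp_div (fun η : ℝ => cexp (↑(2 * Real.pi * inner ℝ η x) * I)
    • (𝓕 f : Lp ℂ 2 (volume : Measure ℝ)) η) (2 * Real.pi)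
  rw [hx, Real.fourierInv_eq', schrodingerOp]
  have e : ∀ ξ : ℝ, cexp (I * ((x * ξ + 0 * |ξ| ^ a : ℝ) : ℂ)) * angularFourier f ξ
      = cexp (↑(2 * Real.pi * inner ℝ (ξ / (2 * Real.pi)) x) * I)
        • (𝓕 f : Lp ℂ 2 (volume : Measure ℝ)) (ξ / (2 * Real.pi)) := by
    intro ξ
    rw [smul_eq_mul, angularFourier]
    congr 2
    have : inner ℝ (ξ / (2 * Real.pi)) x = x * (ξ / (2 * Real.pi)) := rfl
    rw [this, mul_comm I]
    congr 2
    field_simp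
    ring
  simp_rw [e]
  rw [h, abs_of_pos Real.two_pi_pos, real_smul, ← mul_assoc]
  have : (1 / (2 * Real.pi) : ℂ) * ((2 * Real.pi : ℝ) : ℂ) = 1 := by
    push_cast
    field_simp
  rw [this, one_mul]

/-- The solution with frequencies in `{R/Λ ≤ |ξ| ≤ ΛR}`, as a superposition of a left-moving and a
right-moving wave at unit frequency. -/
theorem schrodingerOp_eq_oscOp (a : ℝ) {f : Lp ℂ 2 (volume : Measure ℝ)} {Λ R : ℝ} (hΛ : 1 ≤ Λ)
    (hR : 0 < R) (hf : FourierSupportedIn f (annulus Λ R)) (x t : ℝ) :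
    schrodingerOp a f x t = (1 / (2 * Real.pi) : ℂ) * (R * (
      oscOp a Λ⁻¹ Λ (fun η => angularFourier f (R * η)) (R * x) (R ^ a * t)
        + oscOp a Λ⁻¹ Λ (fun η => angularFourier f (-R * η)) (-R * x) (R ^ a * t))) := by
  have hΛ0 : 0 < Λ := by linarith
  set h : ℝ → ℂ := fun ξ =>
    cexp (I * ((x * ξ + t * |ξ| ^ a : ℝ) : ℂ)) * angularFourier f ξ with hh
  have hi : Integrable h := by
    refine (integrable_angularFourier hf).bdd_mul (c := 1)
      (Measurable.aestronglyMeasurable (by fun_prop)) (Filter.Eventually.of_forall fun ξ => ?_)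
    rw [norm_exp_I_mul_ofReal]
  have half : ∀ s : ℝ, |s| = 1 → ∫ ξ in Ioi (0 : ℝ), h (s * ξ)
      = R * oscOp a Λ⁻¹ Λ (fun η => angularFourier f (s * R * η)) (s * R * x) (R ^ a * t) := by
    intro s hs
    have hs0 : s ≠ 0 := by
      rintro rfl
      simp at hs
    have e1 := integral_comp_mul_left_Ioi (fun ξ => h (s * ξ)) 0 hR
    rw [mul_zero] at e1
    rw [← smul_inv_smul₀ hR.ne' (∫ ξ in Ioi (0 : ℝ), h (s * ξ)), ← e1, real_smul]
    congr 1
    have hsub : Icc Λ⁻¹ Λ ⊆ Ioi 0 := fun η hη => (inv_pos.mpr hΛ0).trans_le hη.1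
    have hz : ∀ᵐ η : ℝ, η ∈ Ioi 0 \ Icc Λ⁻¹ Λ → h (s * (R * η)) = 0 := by
      filter_upwards [ae_comp_mul_left (mul_ne_zero hs0 hR.ne') hf] with η hη hmem
      have h0 : 0 < η := hmem.1
      have : angularFourier f (s * R * η) = 0 := by
        refine hη fun hann => hmem.2 ?_
        rw [annulus, mem_ofPred_eq, abs_mul, abs_mul, hs, one_mul, abs_of_pos hR, abs_of_pos h0]
          at hann
        constructor
        · refine le_of_mul_le_mul_left ?_ hR
          rw [← div_eq_mul_inv]
          exact hann.1
        · refine le_of_mul_le_mul_left ?_ hR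
          rw [mul_comm R Λ]
          exact hann.2
      simp only [hh, ← mul_assoc, this, mul_zero]
    rw [setIntegral_eq_of_subset_of_ae_sdiff_eq_zero measurableSet_Ioi.nullMeasurableSet hsub hz,
      oscOp]
    refine setIntegral_congr_fun measurableSet_Icc fun η hη => ?_
    have h0 : 0 < η := hsub hη
    simp only [hh, ← mul_assoc]
    congr 3
    rw [abs_mul, abs_mul, hs, one_mul, abs_of_pos hR, abs_of_pos h0, Real.mul_rpow hR.le h0.le]
    push_cast
    ring
  have hp := half 1 (by simp)
  have hm := half (-1) (by simp)
  simp only [one_mul, neg_one_mul] at hp hm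
  rw [integral_comp_neg_Ioi, neg_zero] at hm
  rw [schrodingerOp, ← intervalIntegral.integral_Iic_add_Ioi hi.integrableOn hi.integrableOn
    (b := 0), hp, hm]
  ring

theorem measurable_oscRate {a b B : ℝ} {G : ℝ → ℂ}
    (hG : Integrable G (volume.restrict (Icc b B))) (δ N : ℝ) :
    Measurable (oscRate a δ b B G N) := by
  have hc := continuous_oscOp (a := a) hG
  refine LowerSemicontinuous.measurable (lowerSemicontinuous_biSup fun τ _ => ?_)
  have h : ∀ τ : ℝ, Continuous fun x => oscOp a b B G x τ := fun τ =>
    hc.comp (Continuous.prodMk continuous_id continuous_const)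
  exact (ENNReal.continuous_mul_const ENNReal.ofReal_ne_top |>.comp
    ((h τ).sub (h 0)).enorm).lowerSemicontinuous

/-- The maximal difference quotient in terms of the ones at unit frequency. -/
theorem ae_maximalRate_le (a δ : ℝ) {f : Lp ℂ 2 (volume : Measure ℝ)} {Λ R : ℝ} (hΛ : 1 ≤ Λ)
    (hR : 0 < R) (hf : FourierSupportedIn f (annulus Λ R)) :
    ∀ᵐ x : ℝ, maximalRate a δ f x ≤ ENNReal.ofReal (1 / (2 * Real.pi) * (R * R ^ (a * δ))) * (
      oscRate a δ Λ⁻¹ Λ (fun η => angularFourier f (R * η)) (R ^ a) (R * x)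
        + oscRate a δ Λ⁻¹ Λ (fun η => angularFourier f (-R * η)) (R ^ a) (-R * x)) := by
  filter_upwards [ae_eq_schrodingerOp_zero a (integrable_angularFourier hf)] with x hx
  refine iSup₂_le fun t ht => ?_
  have hRa : 0 < R ^ a := Real.rpow_pos_of_pos hR a
  have hmem : R ^ a * t ∈ Ioo 0 (R ^ a) :=
    ⟨mul_pos hRa ht.1, mul_lt_of_lt_one_right hRa ht.2⟩
  have hle : ∀ (G : ℝ → ℂ) (y : ℝ), ‖oscOp a Λ⁻¹ Λ G y (R ^ a * t) - oscOp a Λ⁻¹ Λ G y 0‖ₑ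
      * ENNReal.ofReal ((R ^ a * t) ^ (-δ)) ≤ oscRate a δ Λ⁻¹ Λ G (R ^ a) y := fun G y =>
    le_iSup₂ (f := fun τ (_ : τ ∈ Ioo (0 : ℝ) (R ^ a)) =>
      ‖oscOp a Λ⁻¹ Λ G y τ - oscOp a Λ⁻¹ Λ G y 0‖ₑ * ENNReal.ofReal (τ ^ (-δ))) _ hmem
  have ht' : ‖(((|t| ^ δ : ℝ) : ℂ))⁻¹‖ₑ = ENNReal.ofReal (t ^ (-δ)) := by
    rw [← ofReal_norm, norm_inv, norm_real, abs_of_pos ht.1,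
      Real.norm_of_nonneg (Real.rpow_nonneg ht.1.le δ), Real.rpow_neg ht.1.le]
  have hpow : ENNReal.ofReal (t ^ (-δ))
      = ENNReal.ofReal (R ^ (a * δ)) * ENNReal.ofReal ((R ^ a * t) ^ (-δ)) := by
    rw [← ENNReal.ofReal_mul (by positivity), Real.mul_rpow hRa.le ht.1.le, ← Real.rpow_mul hR.le,
      ← mul_assoc, ← Real.rpow_add hR]
    simp
  have hconst : ‖(1 / (2 * Real.pi) : ℂ) * (R : ℂ)‖ₑ = ENNReal.ofReal (1 / (2 * Real.pi) * R) := by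
    have : (1 / (2 * Real.pi) : ℂ) * (R : ℂ) = ((1 / (2 * Real.pi) * R : ℝ) : ℂ) := by
      push_cast
      rfl
    rw [this, ← ofReal_norm, norm_real, Real.norm_of_nonneg (by positivity)]
  have hsub := schrodingerOp_eq_oscOp a hΛ hR hf x
  rw [rateQuotient, hx, hsub t, hsub 0, mul_zero, div_eq_mul_inv, enorm_mul, ht', ← mul_assoc,
    ← mul_assoc, ← mul_sub, enorm_mul, hconst, add_sub_add_comm, hpow]
  have h₁ := hle (fun η => angularFourier f (R * η)) (R * x)
  have h₂ := hle (fun η => angularFourier f (-R * η)) (-R * x)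
  generalize oscOp a Λ⁻¹ Λ (fun η => angularFourier f (R * η)) (R * x) (R ^ a * t)
    - oscOp a Λ⁻¹ Λ (fun η => angularFourier f (R * η)) (R * x) 0 = d₁ at h₁ ⊢
  generalize oscOp a Λ⁻¹ Λ (fun η => angularFourier f (-R * η)) (-R * x) (R ^ a * t)
    - oscOp a Λ⁻¹ Λ (fun η => angularFourier f (-R * η)) (-R * x) 0 = d₂ at h₂ ⊢
  rw [← mul_assoc (1 / (2 * Real.pi)), ENNReal.ofReal_mul (p := 1 / (2 * Real.pi) * R)
    (by positivity)]
  calc ENNReal.ofReal (1 / (2 * Real.pi) * R) * ‖d₁ + d₂‖ₑ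
        * (ENNReal.ofReal (R ^ (a * δ)) * ENNReal.ofReal ((R ^ a * t) ^ (-δ)))
      ≤ ENNReal.ofReal (1 / (2 * Real.pi) * R) * (‖d₁‖ₑ + ‖d₂‖ₑ)
        * (ENNReal.ofReal (R ^ (a * δ)) * ENNReal.ofReal ((R ^ a * t) ^ (-δ))) := by
        gcongr
        exact enorm_add_le _ _
    _ = ENNReal.ofReal (1 / (2 * Real.pi) * R) * ENNReal.ofReal (R ^ (a * δ))
        * (‖d₁‖ₑ * ENNReal.ofReal ((R ^ a * t) ^ (-δ))
          + ‖d₂‖ₑ * ENNReal.ofReal ((R ^ a * t) ^ (-δ))) := by ring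
    _ ≤ _ := by gcongr

/-- The frequency-localised estimate before summation over the dyadic times: `2^J` bounds either the
rescaled times, or the radius of the rescaled ball. -/
theorem exists_eLpNorm_maximalRate_le {a δ Λ : ℝ} (ha0 : 0 < a) (ha1 : a ≠ 1) (hδ0 : 0 ≤ δ)
    (hδ1 : δ < 1) (hΛ : 1 ≤ Λ) :
    ∃ C : ℝ, 0 < C ∧ ∀ k J : ℕ, (((2 : ℝ) ^ k) ^ a ≤ 2 ^ J ∨ k ≤ J) →
      ∀ f : Lp ℂ 2 (volume : Measure ℝ), FourierSupportedIn f (annulus Λ ((2 : ℝ) ^ k)) →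
        eLpNorm (maximalRate a δ f) 2 (volume.restrict (Metric.ball (0 : ℝ) 1))
          ≤ ENNReal.ofReal (C * (((2 : ℝ) ^ k) ^ (a * δ)
              * ∑ j ∈ Finset.range (J + 1), ((2 : ℝ) ^ (1 / 4 - δ)) ^ j)) * eLpNorm f 2 volume := by
  have hΛ0 : 0 < Λ := by linarith
  obtain ⟨C, hC, h⟩ := exists_eLpNorm_oscRate_le ha0 ha1 (inv_pos.mpr hΛ0)
    ((inv_le_one_of_one_le₀ hΛ).trans hΛ) hδ0 hδ1
  refine ⟨1 / (2 * Real.pi) * (2 * (C * √(2 * Real.pi))), by positivity, fun k J hkJ f hf => ?_⟩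
  set R : ℝ := (2 : ℝ) ^ k with hR'
  have hR : 0 < R := by positivity
  set S : ℝ := ∑ j ∈ Finset.range (J + 1), ((2 : ℝ) ^ (1 / 4 - δ)) ^ j with hS
  have hS0 : 0 ≤ S := Finset.sum_nonneg fun j _ => by positivity
  have hJ : R ^ a ≤ 2 ^ J ∨ R ≤ 2 ^ J :=
    hkJ.imp id fun h => pow_le_pow_right₀ one_le_two h
  set D := eLpNorm f 2 volume with hD
  have main : ∀ c : ℝ, |c| = R →
      MemLp (fun η => angularFourier f (c * η)) 2 (volume.restrict (Icc Λ⁻¹ Λ)) ∧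
      eLpNorm (fun x => oscRate a δ Λ⁻¹ Λ (fun η => angularFourier f (c * η)) (R ^ a) (c * x)) 2
        (volume.restrict (Metric.ball (0 : ℝ) 1))
        ≤ ENNReal.ofReal (R⁻¹ * (C * S * √(2 * Real.pi))) * D := by
    intro c hc
    have hc0 : c ≠ 0 := abs_pos.mp (hc ▸ hR)
    set G : ℝ → ℂ := fun η => angularFourier f (c * η) with hG
    have hGn : eLpNorm G 2 (volume.restrict (Icc Λ⁻¹ Λ))
        ≤ ENNReal.ofReal (√R⁻¹ * √(2 * Real.pi)) * D := by
      have h1 := eLpNorm_two_comp_mul_left hc0 (angularFourier f) univ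
      rw [preimage_univ, Measure.restrict_univ, abs_inv, hc, eLpNorm_angularFourier, ← mul_assoc,
        ← ENNReal.ofReal_mul (Real.sqrt_nonneg _)] at h1
      exact (eLpNorm_restrict_le _ _ _ _).trans h1.le
    have hGm : MemLp G 2 (volume.restrict (Icc Λ⁻¹ Λ)) := by
      refine ⟨((measurable_angularFourier f).comp (by fun_prop)).aestronglyMeasurable,
        hGn.trans_lt (ENNReal.mul_lt_top ENNReal.ofReal_lt_top (Lp.eLpNorm_lt_top f))⟩
    refine ⟨hGm, ?_⟩
    have hball : (fun x => c * x) ⁻¹' Metric.ball 0 R = Metric.ball (0 : ℝ) 1 := by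
      ext x
      rw [mem_preimage, mem_ball_zero_iff, mem_ball_zero_iff, norm_mul, Real.norm_eq_abs c, hc]
      exact mul_lt_iff_lt_one_right hR
    rw [← hball, eLpNorm_two_comp_mul_left hc0, abs_inv, hc]
    calc ENNReal.ofReal √R⁻¹ * eLpNorm (oscRate a δ Λ⁻¹ Λ G (R ^ a)) 2
          (volume.restrict (Metric.ball 0 R))
        ≤ ENNReal.ofReal √R⁻¹ * (ENNReal.ofReal (C * S)
          * (ENNReal.ofReal (√R⁻¹ * √(2 * Real.pi)) * D)) := by
          gcongr
          refine (h J R (R ^ a) (by positivity) hJ G hGm).trans ?_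
          gcongr
      _ = _ := by
          rw [← mul_assoc, ← mul_assoc, ← ENNReal.ofReal_mul (by positivity),
            ← ENNReal.ofReal_mul (by positivity)]
          congr 2
          have : √R⁻¹ * √R⁻¹ = R⁻¹ := Real.mul_self_sqrt (by positivity)
          linear_combination (C * S * √(2 * Real.pi)) * this
  obtain ⟨p1, p2⟩ := main R (abs_of_pos hR)
  obtain ⟨m1, m2⟩ := main (-R) (by rw [abs_neg, abs_of_pos hR])
  have meas : ∀ c : ℝ,
      MemLp (fun η => angularFourier f (c * η)) 2 (volume.restrict (Icc Λ⁻¹ Λ)) →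
      AEStronglyMeasurable (fun x => oscRate a δ Λ⁻¹ Λ (fun η => angularFourier f (c * η)) (R ^ a)
        (c * x)) (volume.restrict (Metric.ball (0 : ℝ) 1)) := fun c hc =>
    ((measurable_oscRate (hc.integrable (by norm_num)) δ _).comp
      (measurable_const_mul c)).aestronglyMeasurable
  calc eLpNorm (maximalRate a δ f) 2 (volume.restrict (Metric.ball (0 : ℝ) 1))
      ≤ eLpNorm (fun x => ENNReal.ofReal (1 / (2 * Real.pi) * (R * R ^ (a * δ))) * (
          oscRate a δ Λ⁻¹ Λ (fun η => angularFourier f (R * η)) (R ^ a) (R * x)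
          + oscRate a δ Λ⁻¹ Λ (fun η => angularFourier f (-R * η)) (R ^ a) (-R * x))) 2
          (volume.restrict (Metric.ball (0 : ℝ) 1)) := by
        refine eLpNorm_mono_enorm_ae (ae_restrict_of_ae ?_)
        filter_upwards [ae_maximalRate_le a δ hΛ hR hf] with x hx
        simpa only [enorm_eq_self] using hx
    _ ≤ ENNReal.ofReal (1 / (2 * Real.pi) * (R * R ^ (a * δ)))
        * (ENNReal.ofReal (R⁻¹ * (C * S * √(2 * Real.pi))) * D
          + ENNReal.ofReal (R⁻¹ * (C * S * √(2 * Real.pi))) * D) := by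
        rw [eLpNorm_two_const_mul _ ENNReal.ofReal_ne_top]
        gcongr
        exact (eLpNorm_add_le (meas R p1) (meas (-R) m1) one_le_two).trans (add_le_add p2 m2)
    _ = _ := by
        rw [← add_mul, ← ENNReal.ofReal_add (by positivity) (by positivity), ← mul_assoc,
          ← ENNReal.ofReal_mul (by positivity)]
        congr 2
        field_simp
        ring

end Transfer

/-! ### Summation over the dyadic times -/

theorem LocalizedMaximalEstimate.of_le_mul {a δ : ℝ} {w w' : ℕ → ℝ} {K : ℝ} (hK : 0 < K)
    (h : LocalizedMaximalEstimate a δ w) (hw : ∀ k, 1 ≤ k → w k ≤ K * w' k) :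
    LocalizedMaximalEstimate a δ w' := by
  intro Λ hΛ
  obtain ⟨C, hC, hCk⟩ := h Λ hΛ
  refine ⟨C * K, by positivity, fun k hk f hf => (hCk k hk f hf).trans ?_⟩
  refine mul_le_mul' (ENNReal.ofReal_le_ofReal ?_) le_rfl
  rw [mul_assoc]
  exact mul_le_mul_of_nonneg_left (hw k hk) hC.le

/-- The localised estimate, given a number `J k` of dyadic times which is at least `k a` or at least
`k`, and a bound for the sum over the dyadic times. -/
theorem localizedMaximalEstimate_of_sum_le {a δ : ℝ} (ha0 : 0 < a) (ha1 : a ≠ 1) (hδ0 : 0 ≤ δ)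
    (hδ1 : δ < 1) {J : ℕ → ℕ} (hJ : ∀ k : ℕ, ((2 : ℝ) ^ k) ^ a ≤ 2 ^ J k ∨ k ≤ J k) {w : ℕ → ℝ}
    {K : ℝ} (hK : 0 < K) (hw : ∀ k : ℕ, 1 ≤ k →
      ((2 : ℝ) ^ k) ^ (a * δ) * ∑ j ∈ Finset.range (J k + 1), ((2 : ℝ) ^ (1 / 4 - δ)) ^ j
        ≤ K * w k) :
    LocalizedMaximalEstimate a δ w := by
  refine LocalizedMaximalEstimate.of_le_mul (w := fun k => ((2 : ℝ) ^ k) ^ (a * δ)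
    * ∑ j ∈ Finset.range (J k + 1), ((2 : ℝ) ^ (1 / 4 - δ)) ^ j) hK (fun Λ hΛ => ?_) hw
  obtain ⟨C, hC, h⟩ := exists_eLpNorm_maximalRate_le ha0 ha1 hδ0 hδ1 hΛ
  exact ⟨C, hC, fun k _ f hf => h k (J k) (hJ k) f hf⟩

/-- Both estimates, when `kθ + O(1)` dyadic times suffice at frequency `2^k`. The exponent `s`
combines the scaling factor `2^{kaδ}` with the largest term `2^{kθ(1/4 - δ)⁺}` of the sum
over the times. -/
theorem localizedMaximalEstimate_of_dyadic {a δ θ : ℝ} (ha0 : 0 < a) (ha1 : a ≠ 1) (hδ0 : 0 ≤ δ)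
    (hδ1 : δ < 1) (hθ : θ ≤ 1) {J : ℕ → ℕ}
    (hJ : ∀ k : ℕ, ((2 : ℝ) ^ k) ^ a ≤ 2 ^ J k ∨ k ≤ J k) (hJle : ∀ k : ℕ, (J k : ℝ) ≤ k * θ + 1)
    {s : ℝ} (hs : s = a * δ + θ * (max δ (1 / 4) - δ)) :
    LocalizedMaximalEstimate a δ (fun k => (k : ℝ) * (2 : ℝ) ^ ((k : ℝ) * s)) ∧
      (δ ≠ 1 / 4 → LocalizedMaximalEstimate a δ (fun k => (2 : ℝ) ^ ((k : ℝ) * s))) := by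
  set m : ℝ := max δ (1 / 4) - δ with hm
  have hm0 : 0 ≤ m := sub_nonneg.mpr (le_max_left _ _)
  have hpow : ∀ k : ℕ, ((2 : ℝ) ^ k) ^ (a * δ) * ((2 : ℝ) ^ m) ^ J k
      ≤ 2 ^ m * (2 : ℝ) ^ ((k : ℝ) * s) := by
    intro k
    rw [← Real.rpow_natCast, ← Real.rpow_natCast, ← Real.rpow_mul zero_le_two,
      ← Real.rpow_mul zero_le_two, ← Real.rpow_add two_pos, ← Real.rpow_add two_pos]
    refine Real.rpow_le_rpow_of_exponent_le one_le_two ?_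
    rw [hs]
    nlinarith [mul_le_mul_of_nonneg_left (hJle k) hm0]
  constructor
  · refine localizedMaximalEstimate_of_sum_le ha0 ha1 hδ0 hδ1 hJ (K := 3 * 2 ^ m) (by positivity)
      fun k hk => ?_
    have hk1 : (1 : ℝ) ≤ k := by exact_mod_cast hk
    have hJk : (J k : ℝ) + 1 ≤ 3 * k := by nlinarith [hJle k]
    calc ((2 : ℝ) ^ k) ^ (a * δ) * ∑ j ∈ Finset.range (J k + 1), ((2 : ℝ) ^ (1 / 4 - δ)) ^ j
        ≤ ((2 : ℝ) ^ k) ^ (a * δ) * (3 * k * ((2 : ℝ) ^ m) ^ J k) := by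
          refine mul_le_mul_of_nonneg_left ?_ (by positivity)
          exact (sum_pow_le_mul_rpow δ (J k)).trans (by gcongr)
      _ = 3 * k * (((2 : ℝ) ^ k) ^ (a * δ) * ((2 : ℝ) ^ m) ^ J k) := by ring
      _ ≤ 3 * k * (2 ^ m * (2 : ℝ) ^ ((k : ℝ) * s)) :=
          mul_le_mul_of_nonneg_left (hpow k) (by positivity)
      _ = _ := by ring
  · intro hδ4
    obtain ⟨C, hC, hCJ⟩ := exists_sum_pow_le_rpow hδ4
    refine localizedMaximalEstimate_of_sum_le ha0 ha1 hδ0 hδ1 hJ (K := C * 2 ^ m) (by positivity)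
      fun k _ => ?_
    calc ((2 : ℝ) ^ k) ^ (a * δ) * ∑ j ∈ Finset.range (J k + 1), ((2 : ℝ) ^ (1 / 4 - δ)) ^ j
        ≤ ((2 : ℝ) ^ k) ^ (a * δ) * (C * ((2 : ℝ) ^ m) ^ J k) :=
          mul_le_mul_of_nonneg_left (hCJ (J k)) (by positivity)
      _ = C * (((2 : ℝ) ^ k) ^ (a * δ) * ((2 : ℝ) ^ m) ^ J k) := by ring
      _ ≤ C * (2 ^ m * (2 : ℝ) ^ ((k : ℝ) * s)) := mul_le_mul_of_nonneg_left (hpow k) hC.le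
      _ = _ := by ring

theorem proposition2p2 (a δ : ℝ) (hδ0 : 0 ≤ δ) (hδ1 : δ < 1) :
    (1 < a → ∀ s : ℝ, s = (a - 1) * δ + max δ (1 / 4) →
      LocalizedMaximalEstimate a δ (fun k => (k : ℝ) * (2 : ℝ) ^ ((k : ℝ) * s)) ∧
      (δ ≠ 1 / 4 → LocalizedMaximalEstimate a δ (fun k => (2 : ℝ) ^ ((k : ℝ) * s)))) ∧
    (0 < a → a < 1 → ∀ s : ℝ, s = max δ (1 / 4) * a →
      LocalizedMaximalEstimate a δ (fun k => (k : ℝ) * (2 : ℝ) ^ ((k : ℝ) * s)) ∧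
      (δ ≠ 1 / 4 → LocalizedMaximalEstimate a δ (fun k => (2 : ℝ) ^ ((k : ℝ) * s)))) := by
  constructor
  · intro ha s hs
    refine localizedMaximalEstimate_of_dyadic (θ := 1) (J := fun k => k) (by linarith) ha.ne' hδ0
      hδ1 le_rfl (fun k => Or.inr le_rfl) (fun k => ?_) ?_
    · linarith
    · rw [hs]; ring
  · intro ha0 ha1 s hs
    refine localizedMaximalEstimate_of_dyadic (θ := a) (J := fun k => ⌈(k : ℝ) * a⌉₊) ha0 ha1.ne hδ0
      hδ1 ha1.le (fun k => Or.inl ?_) (fun k => ?_) ?_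
    · rw [← Real.rpow_natCast, ← Real.rpow_natCast, ← Real.rpow_mul zero_le_two]
      exact Real.rpow_le_rpow_of_exponent_le one_le_two (Nat.le_ceil _)
    · exact (Nat.ceil_lt_add_one (by positivity)).le
    · rw [hs]; ring
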